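/- All graphs are finite and may have loops and parallel edges; $M(G)$ denotes the cycle matroid of $G$. Let $M$ be a binary matroid on $E$, let $x,y$ be distinct elements of $E$ and $a\notin E$. Let $A$ be a matrix over $GF(2)$ representing $M$. Adjoin to $A$ a new row that is $1$ in the columns of $x$ and $y$ and $0$ in all other columns, and then a new column, labelled $a$, that is $1$ in the new row and $0$ elsewhere. The vector matroid of the resulting matrix is the element splitting matroid $M'_{x,y}$, with ground set $E\cup\{a\}$. A graphic matroid $M$ is called minimal with respect to a matroid $F$ (and the element splitting operation) if no two elements of $M$ are in series (that is, $M$ has no $2$-element cocircuit) and there are two distinct elements $x,y$ of $M$, neither of them a loop or a coloop of $M$ and not parallel to each other in $M$, such that at least one of the following holds: $$M'_{x,y}\setminus\{a\}/\{x\}\cong F,\quad M'_{x,y}\setminus\{a\}/\{x,y\}\cong F,\quad M'_{x,y}\cong F,\quad M'_{x,y}/\{x\}\cong F,\quad M'_{x,y}/\{x,y\}\cong F.$$ Define the following graphs by their lists of edges ($uv$ is an edge joining $u$ and $v$; an edge listed twice is a pair of parallel edges). - $G_6$, on the vertices $0,\dots,5$: $51, 12, 24, 43, 30, 05, 54, 23,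 02, 13$. - $G_7$, on the vertices $0,\dots,5$: $51, 12, 12, 24, 43, 30, 05, 54, 01, 13$. - $G_8$, on the vertices $0,\dots,5$: $51, 12, 24, 24, 43, 30, 05, 54, 01, 13$. - $G_9$, on the vertices $0,\dots,6$: $34, 45, 52, 21, 10, 03, 63, 64, 62, 60, 51$. - $G_{10}$ (the wheel with four spokes), on the vertices $0,\dots,4$: $01, 12, 23, 30, 40, 41, 42, 43$. **Lemma.** Let $M$ be a graphic matroid. Then $M$ is minimal with respect to $M(K_{3,3})$ if and only if $M$ is isomorphic to $M(G_6)$, $M(G_7)$, $M(G_8)$, $M(G_9)$ or $M(G_{10})$. -/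

import Mathlib

open scoped Matroid

namespace ElementSplitting

/-! ### Vector matroids over `GF(2)` -/

theorem linearIndepOn_augment {β W : Type*} [AddCommGroup W] [Module (ZMod 2) W] (v : β → W)
    {I J : Set β} (hI : LinearIndepOn (ZMod 2) v I) (hIfin : I.Finite)
    (hJ : LinearIndepOn (ZMod 2) v J) (hJfin : J.Finite) (hlt : I.ncard < J.ncard) :
    ∃ e ∈ J, e ∉ I ∧ LinearIndepOn (ZMod 2) v (insert e I) := by
  by_contra! hcon
  have hsub : v '' J ⊆ Submodule.span (ZMod 2) (v '' I) := by
    rintro _ ⟨e, heJ, rfl⟩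
    by_contra hns
    have heI : e ∉ I := fun h => hns (Submodule.subset_span (Set.mem_image_of_mem v h))
    exact hcon e heJ heI (hI.insert hns)
  have := hIfin.fintype
  have := hJfin.fintype
  have hfd : FiniteDimensional (ZMod 2) (Submodule.span (ZMod 2) (v '' I)) :=
    FiniteDimensional.span_of_finite _ (hIfin.image v)
  have hle := Submodule.finrank_mono (Submodule.span_le.2 hsub)
  have h1 := finrank_span_eq_card hI
  have h2 := finrank_span_eq_card hJ
  rw [show Set.range (fun x : I => v x) = v '' I by ext; simp] at h1
  rw [show Set.range (fun x : J => v x) = v '' J by ext; simp] at h2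
  rw [Set.ncard_eq_toFinset_card', Set.ncard_eq_toFinset_card', Set.toFinset_card,
    Set.toFinset_card] at hlt
  omega

/-- The matroid on the ground set `E` whose independent sets are the subsets of `E` on which the
family of vectors `v` over `GF(2)` is linearly independent. -/
def vectorMatroid {β W : Type*} [AddCommGroup W] [Module (ZMod 2) W] (E : Set β) (v : β → W) :
    Matroid β :=
  (IndepMatroid.ofFinitaryCardAugment E (fun I => I ⊆ E ∧ LinearIndepOn (ZMod 2) v I)
    ⟨Set.empty_subset _, linearIndepOn_empty _ _⟩
    (fun _ _ hJ hIJ => ⟨hIJ.trans hJ.1, hJ.2.mono hIJ⟩)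
    (by
      intro I J hI hIfin hJ hJfin hlt
      obtain ⟨e, heJ, heI, he⟩ := linearIndepOn_augment v hI.2 hIfin hJ.2 hJfin hlt
      exact ⟨e, heJ, heI, Set.insert_subset (hJ.1 heJ) hI.1, he⟩)
    (fun I h => ⟨fun e he => (h {e} (by simpa using he) (Set.finite_singleton e)).1 rfl,
      linearIndepOn_of_finite I fun t ht htfin => (h t ht htfin).2⟩)
    (fun _ h => h.1)).matroid

theorem vectorMatroid_ground {β W : Type*} [AddCommGroup W] [Module (ZMod 2) W] (E : Set β)
    (v : β → W) : (vectorMatroid E v).E = E := rfl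

theorem vectorMatroid_indep_iff {β W : Type*} [AddCommGroup W] [Module (ZMod 2) W] (E : Set β)
    (v : β → W) (I : Set β) :
    (vectorMatroid E v).Indep I ↔ I ⊆ E ∧ LinearIndepOn (ZMod 2) v I := Iff.rfl

/-! ### Cycles of a multigraph and the cycle matroid -/

/-- `C` is the edge set of a cycle of the multigraph `G`: there are pairwise distinct vertices
`w 0, …, w k` and pairwise distinct edges `f 0, …, f k` forming `C` such that `f i` joins `w i` to
`w (i + 1)`, indices being taken modulo `k + 1`. A loop is a cycle (`k = 0`), and so is a pair of
parallel edges (`k = 1`). -/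
def IsCycleSet {α β : Type*} (G : Graph α β) (C : Set β) : Prop :=
  ∃ (k : ℕ) (w : Fin (k + 1) → α) (f : Fin (k + 1) → β),
    Function.Injective w ∧ Function.Injective f ∧
      (∀ i, G.IsLink (f i) (w i) (w (i + 1))) ∧ C = Set.range f

open Classical in
/-- The column of an edge in the vertex-edge incidence matrix over `GF(2)`: the sum of its two
ends (so a loop gives `0`). -/
noncomputable def incidenceVector {α β : Type*} (G : Graph α β) (e : β) : α →₀ ZMod 2 :=
  if h : ∃ p : α × α, G.IsLink e p.1 p.2 then
    Finsupp.single h.choose.1 1 + Finsupp.single h.choose.2 1 else 0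

theorem incidenceVector_eq {α β : Type*} {G : Graph α β} {e : β} {u v : α}
    (h : G.IsLink e u v) :
    incidenceVector G e = Finsupp.single u 1 + Finsupp.single v 1 := by
  have hex : ∃ p : α × α, G.IsLink e p.1 p.2 := ⟨(u, v), h⟩
  rw [incidenceVector, dif_pos hex]
  rcases hex.choose_spec.eq_and_eq_or_eq_and_eq h with ⟨h1, h2⟩ | ⟨h1, h2⟩
  · rw [h1, h2]
  · rw [h1, h2, add_comm]

theorem IsCycleSet.not_linearIndepOn {α β : Type*} {G : Graph α β} {C : Set β}
    (hC : IsCycleSet G C) : ¬ LinearIndepOn (ZMod 2) (incidenceVector G) C := by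
  classical
  obtain ⟨k, w, f, hw, hf, hl, rfl⟩ := hC
  intro hind
  have hsum : ∑ e ∈ Finset.univ.image f, (1 : ZMod 2) • incidenceVector G e = 0 := by
    rw [Finset.sum_image hf.injOn]
    simp only [one_smul, incidenceVector_eq (hl _), Finset.sum_add_distrib]
    have hshift : ∑ i, (Finsupp.single (w (i + 1)) (1 : ZMod 2) : α →₀ ZMod 2) =
        ∑ i, Finsupp.single (w i) 1 :=
      Fintype.sum_equiv (Equiv.addRight (1 : Fin (k + 1))) _ _ fun _ => rfl
    rw [hshift]
    ext x
    simpa using CharTwo.add_self_eq_zero _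
  have := linearIndepOn_iff'.1 hind (Finset.univ.image f) (fun _ => 1) (by simp) hsum (f 0)
    (by simp)
  exact one_ne_zero this

/-- A finite non-empty set of edges in which every edge can be continued at each of its ends by
another edge of the set contains a cycle. -/
theorem exists_isCycleSet_of_step {α β : Type*} {G : Graph α β} {S : Set β} (hS : S.Finite)
    (hne : S.Nonempty) (hSG : S ⊆ G.edgeSet)
    (step : ∀ e ∈ S, ∀ u v, G.IsLink e u v → u ≠ v → ∃ e' ∈ S, e' ≠ e ∧ ∃ z, G.IsLink e' v z) :
    ∃ C ⊆ S, IsCycleSet G C := by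
  classical
  by_cases hloop : ∃ e ∈ S, ∃ u, G.IsLink e u u
  · obtain ⟨e, he, u, hu⟩ := hloop
    refine ⟨{e}, by simpa using he, 0, fun _ => u, fun _ => e, ?_, ?_, fun _ => hu, by simp⟩ <;>
      exact fun a b _ => Fin.ext (by omega)
  push Not at hloop
  let D := {d : β × α × α // d.1 ∈ S ∧ G.IsLink d.1 d.2.1 d.2.2}
  have hstep : ∀ d : D, ∃ d' : D, d'.1.1 ≠ d.1.1 ∧ d'.1.2.1 = d.1.2.2 := by
    rintro ⟨⟨e, u, v⟩, he, hl⟩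
    obtain ⟨e', he', hee, z, hz⟩ := step e he u v hl (fun h => hloop e he u (by simpa [h] using hl))
    exact ⟨⟨(e', v, z), he', hz⟩, hee, rfl⟩
  choose nxt hnxt1 hnxt2 using hstep
  obtain ⟨e0, he0⟩ := hne
  obtain ⟨u0, v0, hl0⟩ := Graph.exists_isLink_of_mem_edgeSet (hSG he0)
  let d : ℕ → D := fun n => nxt^[n] ⟨(e0, u0, v0), he0, hl0⟩
  have hd : ∀ n, d (n + 1) = nxt (d n) := fun n => Function.iterate_succ_apply' _ _ _
  let f : ℕ → β := fun n => (d n).1.1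
  let w : ℕ → α := fun n => (d n).1.2.1
  have hfS : ∀ n, f n ∈ S := fun n => (d n).2.1
  have hlink : ∀ n, G.IsLink (f n) (w n) (w (n + 1)) := fun n => by
    have h := (d n).2.2
    have h2 : w (n + 1) = (d n).1.2.2 := by simp only [w, hd]; exact hnxt2 _
    rw [h2]; exact h
  have hfne : ∀ n, f (n + 1) ≠ f n := fun n => by simp only [f, hd]; exact hnxt1 _
  -- some vertex repeats
  have hfinV : (⋃ e ∈ S, {x | ∃ y, G.IsLink e x y}).Finite := by
    refine hS.biUnion fun e he => ?_
    obtain ⟨a, b, hab⟩ := Graph.exists_isLink_of_mem_edgeSet (hSG he)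
    refine (Set.toFinite ({a, b} : Set α)).subset ?_
    rintro x ⟨y, hxy⟩
    rcases hxy.eq_and_eq_or_eq_and_eq hab with ⟨h, -⟩ | ⟨h, -⟩ <;> simp [h]
  have hrep : ∃ j, ∃ i < j, w i = w j := by
    obtain ⟨i, -, j, -, hij, hw⟩ := Set.infinite_univ.exists_ne_map_eq_of_mapsTo
      (f := w) (t := ⋃ e ∈ S, {x | ∃ y, G.IsLink e x y})
      (fun n _ => Set.mem_biUnion (hfS n) ⟨_, hlink n⟩) hfinV
    rcases lt_or_gt_of_ne hij with h | h
    · exact ⟨j, i, h, hw⟩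
    · exact ⟨i, j, h, hw.symm⟩
  obtain ⟨i, hij, hwij⟩ := Nat.find_spec hrep
  have hmin : ∀ j' < Nat.find hrep, ∀ i' < j', w i' ≠ w j' := fun j' hj' i' hi' h =>
    Nat.find_min hrep hj' ⟨i', hi', h⟩
  generalize Nat.find hrep = j at hij hwij hmin
  have hinj : ∀ a < j, ∀ b < j, w a = w b → a = b := by
    intro a ha b hb hab
    rcases lt_trichotomy a b with h | h | h
    · exact (hmin b hb a h hab).elim
    · exact h
    · exact (hmin a ha b h hab.symm).elim
  have hfinj : ∀ a b, i ≤ a → a < b → b < j → f a ≠ f b := by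
    intro a b hia hab hbj hf
    have h1 := hlink a
    have h2 := hlink b
    rw [← hf] at h2
    rcases h1.eq_and_eq_or_eq_and_eq h2 with ⟨h, -⟩ | ⟨h, h'⟩
    · exact hab.ne (hinj a (by omega) b hbj h)
    · have hb : b = a + 1 := (hinj (a + 1) (by omega) b hbj h').symm
      exact hfne a (by rw [← hb, hf])
  obtain ⟨k, rfl⟩ : ∃ k, j = i + k + 1 := ⟨j - i - 1, by omega⟩
  refine ⟨Set.range fun t : Fin (k + 1) => f (i + t), ?_, k, fun t => w (i + t),
    fun t => f (i + t), ?_, ?_, ?_, rfl⟩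
  · rintro _ ⟨t, rfl⟩
    exact hfS _
  · intro s t hst
    have := hinj (i + s) (by omega) (i + t) (by omega) hst
    exact Fin.ext (by omega)
  · intro s t hst
    rcases lt_trichotomy s.1 t.1 with h | h | h
    · exact (hfinj (i + s) (i + t) (by omega) (by omega) (by omega) hst).elim
    · exact Fin.ext h
    · exact (hfinj (i + t) (i + s) (by omega) (by omega) (by omega) hst.symm).elim
  · intro t
    have h := hlink (i + t)
    by_cases ht : t.1 = k
    · have h0 : t + 1 = 0 := by
        have : t = Fin.last k := Fin.ext ht
        rw [this]; simp
      simp only [h0, Fin.val_zero, Nat.add_zero]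
      rw [hwij]
      simpa [ht] using h
    · have h1 : ((t + 1 : Fin (k + 1)) : ℕ) = t + 1 := by
        rw [Fin.val_add_one_of_lt]
        exact Fin.lt_def.2 (by simp; omega)
      simp only [h1]
      exact h

theorem linearIndepOn_incidenceVector_iff {α β : Type*} (G : Graph α β) (I : Set β) :
    (I ⊆ G.edgeSet ∧ ∀ C ⊆ I, ¬ IsCycleSet G C) ↔
      I ⊆ G.edgeSet ∧ LinearIndepOn (ZMod 2) (incidenceVector G) I := by
  classical
  refine and_congr_right fun hIG => ⟨fun h => ?_, fun h C hCI hC =>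
    hC.not_linearIndepOn (h.mono hCI)⟩
  by_contra hdep
  rw [linearIndepOn_iff'] at hdep
  push Not at hdep
  obtain ⟨t, g, htI, hsum, e0, he0t, hge0⟩ := hdep
  have hS : (((t.filter fun e => g e ≠ 0 : Finset β)) : Set β) ⊆ I := fun e he => by
    simp only [Finset.coe_filter] at he
    exact htI he.1
  have hsum' : ∑ e ∈ t.filter (fun e => g e ≠ 0), incidenceVector G e = 0 := by
    rw [← hsum, Finset.sum_filter]
    refine Finset.sum_congr rfl fun e _ => ?_
    have h2 : ∀ a : ZMod 2, a = 0 ∨ a = 1 := by decide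
    rcases h2 (g e) with h | h <;> simp [h]
  obtain ⟨C, hCS, hC⟩ := exists_isCycleSet_of_step (G := G)
    (S := ((t.filter fun e => g e ≠ 0 : Finset β) : Set β)) (Finset.finite_toSet _)
    ⟨e0, by simp [he0t, hge0]⟩ (hS.trans hIG) (by
      intro e he u v hl huv
      by_contra! hno
      have hz := DFunLike.congr_fun hsum' v
      rw [Finsupp.finsetSum_apply, Finset.sum_eq_single_of_mem e he] at hz
      · rw [incidenceVector_eq hl] at hz
        simp [huv] at hz
      · intro e' he' hne
        obtain ⟨a, b, hab⟩ := Graph.exists_isLink_of_mem_edgeSet (hIG (hS he'))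
        have ha : a ≠ v := fun h => hno e' he' hne b (h ▸ hab)
        have hb : b ≠ v := fun h => hno e' he' hne a (h ▸ hab.symm)
        rw [incidenceVector_eq hab]
        simp [ha, hb])
  exact h C (hCS.trans hS) hC

/-- The cycle matroid `M(G)` of a multigraph `G`: its ground set is the edge set of `G`, and a set
of edges is independent when it contains no cycle. -/
noncomputable def cycleMatroid {α β : Type*} (G : Graph α β) : Matroid β :=
  (vectorMatroid G.edgeSet (incidenceVector G)).copyIndep G.edgeSet
    (fun I => I ⊆ G.edgeSet ∧ ∀ C ⊆ I, ¬ IsCycleSet G C) rfl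
    (linearIndepOn_incidenceVector_iff G)

/-! ### Isomorphism, graphic matroids, element splitting -/

/-- Two matroids are isomorphic: some bijection of the ground sets preserves and reflects
independence. -/
def IsIso {α β : Type*} (M : Matroid α) (N : Matroid β) : Prop :=
  ∃ φ : M.E ≃ N.E, ∀ I : Set M.E,
    M.Indep (Subtype.val '' I) ↔ N.Indep (Subtype.val '' (φ '' I))

/-- A matroid is graphic if it is isomorphic to the cycle matroid of a finite multigraph. -/
def IsGraphic {α : Type*} (M : Matroid α) : Prop :=
  ∃ (n m : ℕ) (G : Graph (Fin n) (Fin m)), IsIso M (cycleMatroid G)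

/-- The vector matroid on the columns, indexed by the elements of `E`, of a matrix over `GF(2)`. -/
def matrixMatroid {ρ α : Type*} (E : Set α) (A : Matrix ρ α (ZMod 2)) : Matroid α :=
  vectorMatroid E A.col

open Classical in
/-- The matrix `A'_X`: a new row (indexed by `none`) is adjoined to `A`, with entry `1` in the
columns of the elements of `X` and `0` in the other columns of `A`, and then a new column (indexed
by `none`) is adjoined, with entry `1` in the new row and `0` elsewhere. -/
noncomputable def splittingMatrix {ρ α : Type*} (A : Matrix ρ α (ZMod 2)) (X : Set α) :
    Matrix (Option ρ) (Option α) (ZMod 2)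
  | some r, some e => A r e
  | some _, none => 0
  | none, some e => if e ∈ X then 1 else 0
  | none, none => 1

/-- `M'` is the element splitting matroid `M'_X` of the binary matroid `M`, on the ground set
`E(M) ∪ {a}` where the new element `a` is `none`: some matrix `A` over `GF(2)` represents `M`, and
`M'` is the vector matroid of `A'_X`. -/
def IsElementSplitting {α : Type*} (M : Matroid α) (X : Set α) (M' : Matroid (Option α)) : Prop :=
  ∃ (m : ℕ) (A : Matrix (Fin m) α (ZMod 2)), M = matrixMatroid M.E A ∧
    M' = matrixMatroid (insert none (some '' M.E)) (splittingMatrix A X)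

/-- `M` is minimal with respect to `F` and the element splitting operation. Two elements are in
series if they form a cocircuit, and parallel if they form a circuit. -/
def IsMinimalWrt {α β : Type*} (M : Matroid α) (F : Matroid β) : Prop :=
  IsGraphic M ∧
  (∀ u v : α, u ≠ v → ¬ M.IsCocircuit {u, v}) ∧
  ∃ x ∈ M.E, ∃ y ∈ M.E, x ≠ y ∧
    ¬ M.IsLoop x ∧ ¬ M.IsLoop y ∧ ¬ M.IsColoop x ∧ ¬ M.IsColoop y ∧ ¬ M.IsCircuit {x, y} ∧
    ∃ M' : Matroid (Option α), IsElementSplitting M {x, y} M' ∧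
      (IsIso (M' ＼ {none} ／ {some x}) F ∨
       IsIso (M' ＼ {none} ／ {some x, some y}) F ∨
       IsIso M' F ∨
       IsIso (M' ／ {some x}) F ∨
       IsIso (M' ／ {some x, some y}) F)

/-! ### The graphs -/

/-- The multigraph with vertex set `Fin n` and edges indexed by `Fin m`, the `i`-th edge joining
the two vertices of the pair `ends i`. -/
def graphOfEnds {n m : ℕ} (ends : Fin m → Fin n × Fin n) : Graph (Fin n) (Fin m) where
  vertexSet := Set.univ
  edgeSet := Set.univ
  IsLink e x y := s((ends e).1, (ends e).2) = s(x, y)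
  isLink_symm _ _ := ⟨fun _ _ h => h.trans Sym2.eq_swap⟩
  eq_or_eq_of_isLink_of_isLink _ x y v w h h' := by
    rcases Sym2.eq_iff.1 (h.symm.trans h') with ⟨h, -⟩ | ⟨h, -⟩
    · exact Or.inl h
    · exact Or.inr h
  edge_mem_iff_exists_isLink e := ⟨fun _ => ⟨_, _, rfl⟩, fun _ => Set.mem_univ e⟩
  left_mem_of_isLink _ x _ _ := Set.mem_univ x

/-- The complete bipartite graph `K_{3,3}`. -/
def graphK33 : Graph (Fin 3 ⊕ Fin 3) (Sym2 (Fin 3 ⊕ Fin 3)) :=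
  Graph.ofSimpleGraph (completeBipartiteGraph (Fin 3) (Fin 3))

/-- In the graphs `graphG6`, `graphG7` and `graphG8` the vertices `5, 1, 2, 4, 3, 0` are the
consecutive corners of a hexagon, starting at the left-most corner. -/
def graphG6 : Graph (Fin 6) (Fin 10) :=
  graphOfEnds ![(5, 1), (1, 2), (2, 4), (4, 3), (3, 0), (0, 5), (5, 4), (2, 3), (0, 2), (1, 3)]

/-- The edge joining `1` and `2` is doubled. -/
def graphG7 : Graph (Fin 6) (Fin 10) :=
  graphOfEnds ![(5, 1), (1, 2), (1, 2), (2, 4), (4, 3), (3, 0), (0, 5), (5, 4), (0, 1), (1, 3)]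

/-- The edge joining `2` and `4` is doubled. -/
def graphG8 : Graph (Fin 6) (Fin 10) :=
  graphOfEnds ![(5, 1), (1, 2), (2, 4), (2, 4), (4, 3), (3, 0), (0, 5), (5, 4), (0, 1), (1, 3)]

/-- The vertices `3, 4, 5, 2, 1, 0` are the consecutive corners of a hexagon, starting at the
left-most corner, and `6` is the vertex in its interior. -/
def graphG9 : Graph (Fin 7) (Fin 11) :=
  graphOfEnds ![(3, 4), (4, 5), (5, 2), (2, 1), (1, 0), (0, 3), (6, 3), (6, 4), (6, 2), (6, 0),
    (5, 1)]

/-- The wheel with four spokes; its hub is the vertex `4`. -/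
def graphG10 : Graph (Fin 5) (Fin 8) :=
  graphOfEnds ![(0, 1), (1, 2), (2, 3), (3, 0), (4, 0), (4, 1), (4, 2), (4, 3)]

end ElementSplitting

namespace ElementSplitting

/-! ### Cycle codes -/

/-! A binary matroid is determined by its cycle space over `GF(2)`, and the proof works with such
codes. The cycles of `M'_{x,y}` are the cycles `c` of `M` extended by `c(a) = c(x) + c(y)`. Deleting
`a` keeps the cycles with `c(x) = c(y)`, and contracting an independent set forgets coordinates.
Each of the five isomorphisms with `M(K_{3,3})`, whose cycle space has dimension 4, therefore nearly
determines the cycle space `K` of `M`.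

If `M' ≅ M(K_{3,3})`, then `M` is `M'` with `a` contracted, which is the wheel `G_10` because all
edges of `K_{3,3}` are alike. If `M' / x ≅ M(K_{3,3})`, then `K` is one of eight explicit codes, and
none of them is graphic under the hypotheses on `M`. If `M' / {x, y} ≅ M(K_{3,3})`, then `M` has ten
elements and `dim K ≤ 4`, which a degree count forbids (`card_add_three_le`).

If `a` is deleted, the cycles with `c(x) = c(y)` form a hyperplane of `K` that projects
isomorphically onto the cycle space of `K_{3,3}`. So `K` has one further generator, which can be
normalised to vanish on four cotree edges (`exists_maskCode_eq`). This leaves 32 candidates when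
only `x` is contracted, and 64 for each of three hyperplanes when both `x` and `y` are. Non-graphic
candidates are discarded and the others are matched with `G_6`, `G_8` or `G_9`.

Graphicness is refuted through vertex stars (`possiblyGraphic_eq_true`). Without loops, coloops and
series pairs every nonzero cocycle has at least three elements. A graph with cycle space `K` has at
least `|E| - dim K + 1` vertices meeting an edge. Their stars are cocycles that cover every edge
exactly twice, and a finite search shows when no such family exists.

For the converse, each listed graph is labelled so that its code is one of those found above, and
the required minor is computed. -/

theorem zmod_two_cases (a : ZMod 2) : a = 0 ∨ a = 1 := by
  revert a; decide

theorem zmod_two_add_self {V : Type*} [AddCommGroup V] [Module (ZMod 2) V] (a : V) :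
    a + a = 0 := by
  rw [← two_smul (ZMod 2) a, show (2 : ZMod 2) = 0 from rfl, zero_smul]

theorem range_sdiff_image_compl {ι κ β : Type*} {e : ι → β} (he : Function.Injective e)
    (j : κ → ι) : Set.range e \ e '' (Set.range j)ᶜ = Set.range (e ∘ j) := by
  rw [Set.range_comp e j, ← Set.image_univ, ← Set.image_sdiff he, Set.sdiff_compl, Set.univ_inter]

/-- `K` is the cycle space over `GF(2)` of the binary matroid `N`, whose elements are labelled
by `e`. -/
structure CycleCode {ι β : Type*} (N : Matroid β) (e : ι → β)
    (K : Submodule (ZMod 2) (ι → ZMod 2)) : Prop where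
  inj : Function.Injective e
  range_eq : Set.range e = N.E
  indep_iff : ∀ I : Set ι, N.Indep (e '' I) ↔ ∀ c ∈ K, (∀ i ∉ I, c i = 0) → c = 0

namespace CycleCode

variable {ι κ β γ : Type*} {N : Matroid β} {e : ι → β} {K K' : Submodule (ZMod 2) (ι → ZMod 2)}

theorem mem_ground (h : CycleCode N e K) (i : ι) : e i ∈ N.E :=
  h.range_eq ▸ Set.mem_range_self i

theorem image_subset_ground (h : CycleCode N e K) (I : Set ι) : e '' I ⊆ N.E := by
  rintro _ ⟨i, -, rfl⟩
  exact h.mem_ground i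

theorem exists_eq_image (h : CycleCode N e K) {X : Set β} (hX : X ⊆ N.E) : ∃ I, X = e '' I := by
  rw [← h.range_eq] at hX
  exact ⟨e ⁻¹' X, (Set.image_preimage_eq_of_subset hX).symm⟩

theorem not_indep_of_mem (h : CycleCode N e K) {c : ι → ZMod 2} (hc : c ∈ K)
    (h0 : c ≠ 0) {I : Set ι}
    (hI : ∀ i ∉ I, c i = 0) : ¬ N.Indep (e '' I) := fun hind =>
  h0 ((h.indep_iff I).1 hind c hc hI)

open Classical in
-- Dependence of `I` gives a nonzero cycle supported in `I`. It cannot vanish at a point of `I`,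
-- since the proper subset left over would then be dependent; so it is the indicator of `I`.
theorem indicator_mem_of_isCircuit (h : CycleCode N e K) {I : Set ι} (hI : N.IsCircuit (e '' I)) :
    (fun i => if i ∈ I then 1 else 0) ∈ K := by
  have hn := hI.not_indep
  rw [h.indep_iff] at hn
  push Not at hn
  obtain ⟨c, hc, hcI, hc0⟩ := hn
  convert hc using 1
  funext i
  by_cases hi : i ∈ I
  · rw [if_pos hi]
    refine ((zmod_two_cases (c i)).resolve_left fun h0 => ?_).symm
    have hss : e '' (I \ {i}) ⊂ e '' I :=
      ⟨Set.image_mono Set.sdiff_subset, fun hs =>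
        ((Set.image_subset_image_iff h.inj).1 hs hi).2 rfl⟩
    refine h.not_indep_of_mem hc hc0 ?_ (hI.ssubset_indep hss)
    intro j hj
    by_cases hji : j = i
    · rw [hji, h0]
    · exact hcI j fun hjI => hj ⟨hjI, hji⟩
  · rw [if_neg hi, hcI i hi]

theorem exists_isCircuit_subset_support (h : CycleCode N e K) {c : ι → ZMod 2} (hc : c ∈ K)
    (h0 : c ≠ 0) : ∃ I ⊆ Function.support c, N.IsCircuit (e '' I) := by
  have hd : N.Dep (e '' Function.support c) :=
    ⟨h.not_indep_of_mem hc h0 fun i hi => by simpa using hi, h.image_subset_ground _⟩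
  obtain ⟨C, hCs, hC⟩ := hd.exists_isCircuit_subset
  obtain ⟨I, rfl⟩ := h.exists_eq_image hC.subset_ground
  exact ⟨I, (Set.image_subset_image_iff h.inj).1 hCs, hC⟩

open Classical in
theorem add_indicator_support_ssubset {c : ι → ZMod 2} {I : Set ι} (hI : I ⊆ Function.support c)
    (hne : I.Nonempty) :
    Function.support (c + fun i => if i ∈ I then (1 : ZMod 2) else 0) ⊂ Function.support c := by
  obtain ⟨i, hi⟩ := hne
  have key : ∀ j ∈ I, c j = 1 := fun j hj => (zmod_two_cases _).resolve_left (hI hj)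
  refine ⟨fun j hj => ?_, fun hs => ?_⟩
  · by_cases hjI : j ∈ I
    · exact hI hjI
    · simpa [hjI] using hj
  · have h1 := hs (hI hi)
    rw [Function.mem_support, Pi.add_apply, if_pos hi, key i hi] at h1
    exact h1 rfl

/-- A support-decreasing induction principle for the elements of a cycle space. -/
theorem support_induction [Finite ι] (h : CycleCode N e K) {p : (ι → ZMod 2) → Prop} (h0 : p 0)
    (hadd : ∀ c ∈ K, ∀ I ⊆ Function.support c, N.IsCircuit (e '' I) →
      (∀ d ∈ K, Function.support d ⊂ Function.support c → p d) → p c) :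
    ∀ c ∈ K, p c := by
  intro c hc
  generalize hn : (Function.support c).ncard = n
  induction n using Nat.strong_induction_on generalizing c with
  | _ n ih =>
    by_cases hc0 : c = 0
    · rwa [hc0]
    · obtain ⟨I, hI, hcirc⟩ := h.exists_isCircuit_subset_support hc hc0
      refine hadd c hc I hI hcirc fun d hd hss => ih _ ?_ d hd rfl
      rw [← hn]
      exact Set.ncard_lt_ncard hss (Set.toFinite _)

/-- Circuits depend on the matroid alone and their indicators lie in both codes. Subtracting a
circuit inside the support of a cycle shrinks the support, so every cycle is a sum of circuits. -/
theorem le_of_cycleCode [Finite ι] (h : CycleCode N e K) (h' : CycleCode N e K') : K ≤ K' := by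
  classical
  refine h.support_induction K'.zero_mem fun c hc I hI hcirc ih => ?_
  have h1 := h'.indicator_mem_of_isCircuit hcirc
  have hne : I.Nonempty := (Set.image_nonempty).1 hcirc.nonempty
  have h2 := ih _ (K.add_mem hc (h.indicator_mem_of_isCircuit hcirc))
    (add_indicator_support_ssubset hI hne)
  have h3 := K'.add_mem h2 h1
  rwa [add_assoc, zmod_two_add_self, add_zero] at h3

theorem unique [Finite ι] (h : CycleCode N e K) (h' : CycleCode N e K') : K = K' :=
  le_antisymm (h.le_of_cycleCode h') (h'.le_of_cycleCode h)

/-- A cycle is a disjoint union of circuits, and one of them passes through `i`. -/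
theorem exists_isCircuit_mem [Finite ι] (h : CycleCode N e K) {i : ι} :
    ∀ c ∈ K, c i ≠ 0 → ∃ I ⊆ Function.support c, i ∈ I ∧ N.IsCircuit (e '' I) := by
  classical
  refine h.support_induction (fun h0 => (h0 rfl).elim) fun c hc I hI hcirc ih hci => ?_
  by_cases hiI : i ∈ I
  · exact ⟨I, hI, hiI, hcirc⟩
  · have hne : I.Nonempty := (Set.image_nonempty).1 hcirc.nonempty
    have hss := add_indicator_support_ssubset hI hne
    obtain ⟨J, hJ, hiJ, hJc⟩ := ih _ (K.add_mem hc (h.indicator_mem_of_isCircuit hcirc)) hss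
      (by simpa [hiI] using hci)
    exact ⟨J, hJ.trans hss.subset, hiJ, hJc⟩

theorem isIso {N' : Matroid γ} {e' : ι → γ} (h : CycleCode N e K) (h' : CycleCode N' e' K) :
    IsIso N N' := by
  let φ : N.E ≃ N'.E :=
    (Equiv.setCongr h.range_eq.symm).trans ((Equiv.ofInjective e h.inj).symm.trans
      ((Equiv.ofInjective e' h'.inj).trans (Equiv.setCongr h'.range_eq)))
  have hφ : ∀ i, φ ⟨e i, h.mem_ground i⟩ = ⟨e' i, h'.mem_ground i⟩ := by
    intro i
    have : (Equiv.ofInjective e h.inj).symm ⟨e i, Set.mem_range_self i⟩ = i :=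
      Equiv.ofInjective_symm_apply h.inj i
    apply Subtype.ext
    simp only [φ, Equiv.trans_apply, Equiv.setCongr_apply, Equiv.ofInjective_apply]
    exact congrArg e' this
  refine ⟨φ, fun I => ?_⟩
  obtain ⟨J, hJ⟩ := h.exists_eq_image (X := Subtype.val '' I) (by rintro _ ⟨x, -, rfl⟩; exact x.2)
  have hI : I = (fun i => (⟨e i, h.mem_ground i⟩ : N.E)) '' J := by
    apply Set.image_injective.2 Subtype.val_injective
    rw [hJ, Set.image_image]
  have h2 : Subtype.val '' (φ '' I) = e' '' J := by
    rw [hI, Set.image_image, Set.image_image]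
    exact Set.image_congr fun i _ => by rw [hφ]
  rw [h2, hJ, h.indep_iff, h'.indep_iff]

theorem exists_of_isIso {N' : Matroid γ} (h : CycleCode N e K) (hi : IsIso N N') :
    ∃ e' : ι → γ, CycleCode N' e' K := by
  obtain ⟨φ, hφ⟩ := hi
  refine ⟨fun i => (φ ⟨e i, h.mem_ground i⟩ : γ), fun i j hij => ?_, ?_, fun I => ?_⟩
  · exact h.inj (congrArg Subtype.val (φ.injective (Subtype.ext hij)))
  · ext x
    constructor
    · rintro ⟨i, rfl⟩
      exact (φ _).2
    · intro hx
      obtain ⟨⟨y, hy⟩, hyx⟩ := φ.surjective ⟨x, hx⟩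
      obtain ⟨i, rfl⟩ := h.range_eq.symm ▸ hy
      exact ⟨i, congrArg Subtype.val hyx⟩
  · have := hφ ((fun i => (⟨e i, h.mem_ground i⟩ : N.E)) '' I)
    rw [Set.image_image, Set.image_image, Set.image_image] at this
    rw [← this, ← h.indep_iff]

/-- Relabelling the elements. -/
theorem reindex (h : CycleCode N e K) (σ : κ ≃ ι) :
    CycleCode N (e ∘ σ) (K.map (LinearMap.funLeft (ZMod 2) (ZMod 2) σ)) := by
  refine ⟨h.inj.comp σ.injective, by rw [σ.surjective.range_comp, h.range_eq], fun I => ?_⟩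
  rw [Set.image_comp, h.indep_iff]
  constructor
  · rintro hi _ ⟨c, hc, rfl⟩ hz
    rw [hi c hc, map_zero]
    intro i hiI
    have := hz (σ.symm i) fun hs => hiI ⟨_, hs, by simp⟩
    simpa [LinearMap.funLeft_apply] using this
  · intro hi c hc hz
    have := hi _ (Submodule.mem_map_of_mem hc) fun i hiI => hz _ fun ⟨j, hj, hji⟩ =>
      hiI (σ.injective hji ▸ hj)
    funext i
    simpa using congrFun this (σ.symm i)

/-- The cycle space of a contraction of an independent set is a projection of the cycle space. -/
theorem contract (h : CycleCode N e K) (j : κ → ι) (hj : Function.Injective j)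
    (hind : N.Indep (e '' (Set.range j)ᶜ)) :
    CycleCode (N ／ (e '' (Set.range j)ᶜ)) (e ∘ j)
      (K.map (LinearMap.funLeft (ZMod 2) (ZMod 2) j)) := by
  refine ⟨h.inj.comp hj, ?_, fun I => ?_⟩
  · rw [Matroid.contract_ground, ← h.range_eq, range_sdiff_image_compl h.inj]
  · rw [hind.contract_indep_iff, Set.image_comp, ← Set.image_union, h.indep_iff]
    have hdisj : Disjoint (e '' (j '' I)) (e '' (Set.range j)ᶜ) := by
      rw [Set.disjoint_image_iff h.inj]
      exact Set.disjoint_compl_right_iff_subset.2 (Set.image_subset_range _ _)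
    constructor
    · rintro ⟨-, hi⟩ _ ⟨c, hc, rfl⟩ hz
      rw [hi c hc, map_zero]
      intro i hiI
      simp only [Set.mem_union, Set.mem_compl_iff, not_or, not_not] at hiI
      obtain ⟨h1, k, rfl⟩ := hiI
      exact hz k fun hk => h1 ⟨k, hk, rfl⟩
    · refine fun hi => ⟨hdisj, fun c hc hz => ?_⟩
      have h0 := hi _ (Submodule.mem_map_of_mem hc) fun k hk => hz _ (by
        simp only [Set.mem_union, Set.mem_compl_iff, not_or, not_not]
        exact ⟨fun ⟨k', hk', he⟩ => hk (hj he ▸ hk'), k, rfl⟩)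
      refine (h.indep_iff _).1 hind c hc fun i hi' => ?_
      rw [Set.notMem_compl_iff] at hi'
      obtain ⟨k, rfl⟩ := hi'
      exact congrFun h0 k

/-- The cycle space of a deletion consists of the cycles that avoid the deleted elements. -/
theorem delete (h : CycleCode N e K) (j : κ → ι) (hj : Function.Injective j)
    {L : Submodule (ZMod 2) (κ → ZMod 2)}
    (hL : ∀ d, d ∈ L ↔ ∃ c ∈ K, (∀ i ∉ Set.range j, c i = 0) ∧ c ∘ j = d) :
    CycleCode (N ＼ (e '' (Set.range j)ᶜ)) (e ∘ j) L := by
  refine ⟨h.inj.comp hj, ?_, fun I => ?_⟩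
  · rw [Matroid.delete_ground, ← h.range_eq, range_sdiff_image_compl h.inj]
  · have hdisj : Disjoint (e '' (j '' I)) (e '' (Set.range j)ᶜ) := by
      rw [Set.disjoint_image_iff h.inj]
      exact Set.disjoint_compl_right_iff_subset.2 (Set.image_subset_range _ _)
    rw [Matroid.delete_indep_iff, Set.image_comp, and_iff_left hdisj, h.indep_iff]
    constructor
    · intro hi d hd hz
      obtain ⟨c, hc, hc0, rfl⟩ := (hL d).1 hd
      rw [hi c hc]
      · rfl
      · intro i hiI
        by_cases hir : i ∈ Set.range j
        · obtain ⟨k, rfl⟩ := hir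
          exact hz k fun hk => hiI ⟨k, hk, rfl⟩
        · exact hc0 i hir
    · intro hi c hc hz
      have hout : ∀ i ∉ Set.range j, c i = 0 := fun i hir =>
        hz i fun hiI => hir (Set.image_subset_range _ _ hiI)
      have h0 := hi (c ∘ j) ((hL _).2 ⟨c, hc, hout, rfl⟩) fun k hk => hz _
        fun ⟨k', hk', he⟩ => hk (hj he ▸ hk')
      funext i
      by_cases hir : i ∈ Set.range j
      · obtain ⟨k, rfl⟩ := hir
        exact congrFun h0 k
      · exact hout i hir

/-! ### Loops, coloops, parallel and series pairs -/

theorem isLoop_iff (h : CycleCode N e K) [DecidableEq ι] (i : ι) :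
    N.IsLoop (e i) ↔ Pi.single i 1 ∈ K := by
  rw [← Matroid.singleton_dep, Matroid.Dep, and_iff_left (by simpa using h.mem_ground i),
    ← Set.image_singleton, h.indep_iff]
  push Not
  constructor
  · rintro ⟨c, hc, hz, h0⟩
    convert hc using 1
    funext k
    by_cases hk : k = i
    · subst hk
      rw [Pi.single_eq_same]
      refine ((zmod_two_cases _).resolve_left fun hk0 => h0 ?_).symm
      funext k'
      by_cases hk' : k' = k
      · rw [hk', hk0]; rfl
      · exact hz k' hk'
    · rw [Pi.single_eq_of_ne hk, hz k hk]
  · intro hc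
    exact ⟨_, hc, fun k hk => Pi.single_eq_of_ne hk _, fun h0 => by simpa using congrFun h0 i⟩

/-- Coloops are the elements in no circuit, and a cycle through an element contains a circuit
through it. -/
theorem isColoop_iff [Finite ι] (h : CycleCode N e K) (i : ι) :
    N.IsColoop (e i) ↔ ∀ c ∈ K, c i = 0 := by
  classical
  rw [Matroid.isColoop_iff_forall_notMem_isCircuit (h.mem_ground i)]
  constructor
  · intro hC c hc
    by_contra h0
    obtain ⟨I, -, hiI, hI⟩ := h.exists_isCircuit_mem c hc h0
    exact hC hI ⟨i, hiI, rfl⟩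
  · intro hz C hC hi
    obtain ⟨I, rfl⟩ := h.exists_eq_image hC.subset_ground
    have := hz _ (h.indicator_mem_of_isCircuit hC)
    rw [if_pos ((h.inj.mem_set_image).1 hi)] at this
    exact one_ne_zero this

theorem isCircuit_pair_iff (h : CycleCode N e K) [DecidableEq ι] {i k : ι} (hik : i ≠ k)
    (hi : ¬ N.IsLoop (e i)) (hk : ¬ N.IsLoop (e k)) :
    N.IsCircuit {e i, e k} ↔ Pi.single i 1 + Pi.single k 1 ∈ K := by
  classical
  rw [← Set.image_pair]
  have heq : (fun l => if l ∈ ({i, k} : Set ι) then (1 : ZMod 2) else 0) =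
      Pi.single i 1 + Pi.single k 1 := by
    funext l
    by_cases hl : l = i
    · subst hl; simp [hik]
    · by_cases hl' : l = k
      · subst hl'; simp [hik.symm]
      · simp [hl, hl']
  constructor
  · intro hC
    rw [← heq]
    convert h.indicator_mem_of_isCircuit hC
  · intro hm
    have h0 : (Pi.single i 1 + Pi.single k 1 : ι → ZMod 2) ≠ 0 := fun h0 => by
      simpa [hik] using congrFun h0 i
    obtain ⟨I, hI, hC⟩ := h.exists_isCircuit_subset_support hm h0
    have hsub : I ⊆ {i, k} := fun l hl => by
      have := hI hl
      rw [← heq, Function.mem_support] at this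
      by_contra hl'
      exact this (if_neg hl')
    rcases Set.subset_pair_iff_eq.1 hsub with rfl | rfl | rfl | rfl
    · exact absurd hC.nonempty (by simp)
    · rw [Set.image_singleton, Matroid.singleton_isCircuit] at hC
      exact (hi hC).elim
    · rw [Set.image_singleton, Matroid.singleton_isCircuit] at hC
      exact (hk hC).elim
    · exact hC

/-- A circuit and a cocircuit never meet in exactly one element. A cycle containing just one of the
two elements would contain a circuit that violates this. -/
theorem eq_of_isCocircuit_pair [Finite ι] (h : CycleCode N e K) {i k : ι} (hik : i ≠ k)
    (hC : N.IsCocircuit {e i, e k}) : ∀ c ∈ K, c i = c k := by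
  have key : ∀ i k, i ≠ k → N.IsCocircuit {e i, e k} → ∀ c ∈ K, c i ≠ 0 → c k ≠ 0 := by
    intro i k hik hC c hc hi hk
    obtain ⟨I, hI, hiI, hcirc⟩ := h.exists_isCircuit_mem c hc hi
    refine hcirc.inter_isCocircuit_ne_singleton hC (e := e i) ?_
    ext x
    simp only [Set.mem_inter_iff, Set.mem_insert_iff, Set.mem_singleton_iff]
    constructor
    · rintro ⟨hxI, rfl | rfl⟩
      · rfl
      · exact (hI ((h.inj.mem_set_image).1 hxI) hk).elim
    · rintro rfl
      exact ⟨⟨i, hiI, rfl⟩, Or.inl rfl⟩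
  intro c hc
  rcases zmod_two_cases (c i) with h0 | h1 <;> rcases zmod_two_cases (c k) with h0' | h1'
  · rw [h0, h0']
  · exact (key k i hik.symm (by rwa [Set.pair_comm]) c hc (by simp [h1']) h0).elim
  · exact (key i k hik hC c hc (by simp [h1]) h0').elim
  · rw [h1, h1']

/-- If the pair were coindependent, some base would avoid both elements. The fundamental circuit of
`e i` would then contain `e i` but not `e k`. The first two hypotheses exclude coloops, so the
dependent pair is a minimal one. -/
theorem isCocircuit_pair [Finite ι] (h : CycleCode N e K) {i k : ι} (hik : i ≠ k)
    (hi : ∃ c ∈ K, c i ≠ 0) (hk : ∃ c ∈ K, c k ≠ 0) (heq : ∀ c ∈ K, c i = c k) :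
    N.IsCocircuit {e i, e k} := by
  classical
  have hni : ¬ N.IsColoop (e i) := fun hc => by
    obtain ⟨c, hcK, h0⟩ := hi
    exact h0 ((h.isColoop_iff i).1 hc c hcK)
  have hnk : ¬ N.IsColoop (e k) := fun hc => by
    obtain ⟨c, hcK, h0⟩ := hk
    exact h0 ((h.isColoop_iff k).1 hc c hcK)
  have hsub : {e i, e k} ⊆ N.E := by
    rintro _ (rfl | rfl) <;> exact h.mem_ground _
  have hdep : N✶.Dep {e i, e k} := by
    refine ⟨fun hind => ?_, hsub⟩
    rw [Matroid.dual_indep_iff_exists hsub] at hind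
    obtain ⟨B, hB, hdisj⟩ := hind
    have hiB : e i ∉ B := Set.disjoint_left.1 hdisj (Or.inl rfl)
    have hkB : e k ∉ B := Set.disjoint_left.1 hdisj (Or.inr rfl)
    obtain ⟨C, hCB, hC, hiC⟩ := Matroid.exists_isCircuit_of_mem_closure
      (show e i ∈ N.closure B by rw [hB.closure_eq]; exact h.mem_ground i) hiB
    obtain ⟨I, rfl⟩ := h.exists_eq_image hC.subset_ground
    have h1 := heq _ (h.indicator_mem_of_isCircuit hC)
    rw [if_pos ((h.inj.mem_set_image).1 hiC), if_neg] at h1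
    · exact one_ne_zero h1
    · intro hkI
      rcases hCB ⟨k, hkI, rfl⟩ with h2 | h2
      · exact hik (h.inj h2).symm
      · exact hkB h2
  obtain ⟨C, hCs, hC⟩ := hdep.exists_isCircuit_subset
  rcases Set.subset_pair_iff_eq.1 hCs with rfl | rfl | rfl | rfl
  · exact absurd hC.nonempty (by simp)
  · exact (hni (by rwa [← Matroid.singleton_isCocircuit])).elim
  · exact (hnk (by rwa [← Matroid.singleton_isCocircuit])).elim
  · exact hC

end CycleCode

/-! ### Cycle codes of vector matroids and of graphs -/

/-- The space of linear relations over `GF(2)` between the members of a finite family. -/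
def relations {ι W : Type*} [Fintype ι] [AddCommGroup W] [Module (ZMod 2) W] (v : ι → W) :
    Submodule (ZMod 2) (ι → ZMod 2) :=
  LinearMap.ker (Fintype.linearCombination (ZMod 2) v)

theorem mem_relations {ι W : Type*} [Fintype ι] [AddCommGroup W] [Module (ZMod 2) W] {v : ι → W}
    {c : ι → ZMod 2} : c ∈ relations v ↔ ∑ i, c i • v i = 0 := by
  rw [relations, LinearMap.mem_ker, Fintype.linearCombination_apply]

theorem cycleCode_vectorMatroid {ι β W : Type*} [Fintype ι] [AddCommGroup W] [Module (ZMod 2) W]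
    {E : Set β} (v : β → W) {e : ι → β} (he : Function.Injective e) (hE : Set.range e = E) :
    CycleCode (vectorMatroid E v) e (relations (v ∘ e)) := by
  classical
  refine ⟨he, hE, fun I => ?_⟩
  rw [vectorMatroid_indep_iff, and_iff_right (by rw [← hE]; exact Set.image_subset_range _ _),
    show LinearIndepOn (ZMod 2) v (e '' I) ↔ LinearIndepOn (ZMod 2) (v ∘ e) I from
      ⟨fun h => h.comp_of_image he.injOn, fun h => h.image_of_comp⟩,
    ← Set.coe_toFinset I, linearIndepOn_finset_iff]
  simp only [mem_relations, Finset.mem_coe]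
  constructor
  · intro h c hc hz
    have hz' : ∀ i ∉ I.toFinset, c i = 0 := hz
    rw [← Finset.sum_subset (Finset.subset_univ I.toFinset)
      fun i _ hi => by rw [hz' i hi, zero_smul]] at hc
    funext i
    by_cases hi : i ∈ I.toFinset
    · exact h c hc i hi
    · exact hz i hi
  · intro h c hc i hi
    have := congrFun (h (fun i => if i ∈ I.toFinset then c i else 0) (by
      simp only [ite_smul, zero_smul]
      rw [← Finset.sum_filter, Finset.filter_mem_eq_inter, Finset.univ_inter]
      exact hc) fun i hi => if_neg hi) i
    simpa only [if_pos hi, Pi.zero_apply] using this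

/-- The cycle space of a multigraph whose `i`-th edge joins the two vertices of `p i`. -/
noncomputable def endsCode {ι V : Type*} [Fintype ι] (p : ι → V × V) :
    Submodule (ZMod 2) (ι → ZMod 2) :=
  relations fun i => (Finsupp.single (p i).1 1 + Finsupp.single (p i).2 1 : V →₀ ZMod 2)

theorem mem_endsCode {ι V : Type*} [Fintype ι] [DecidableEq V] {p : ι → V × V}
    {c : ι → ZMod 2} : c ∈ endsCode p ↔ ∀ v, ∑ i, c i *
      ((if (p i).1 = v then 1 else 0) + (if (p i).2 = v then 1 else 0)) = 0 := by
  rw [endsCode, mem_relations, Finsupp.ext_iff]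
  simp [Finsupp.finsetSum_apply, Finsupp.single_apply, mul_add]

theorem cycleMatroid_eq_vectorMatroid {α β : Type*} (G : Graph α β) :
    cycleMatroid G = vectorMatroid G.edgeSet (incidenceVector G) :=
  Matroid.ext_indep rfl fun I _ => linearIndepOn_incidenceVector_iff G I

theorem cycleCode_cycleMatroid {ι α β : Type*} [Fintype ι] (G : Graph α β) {e : ι → β}
    (he : Function.Injective e) (hE : Set.range e = G.edgeSet) (p : ι → α × α)
    (hp : ∀ i, G.IsLink (e i) (p i).1 (p i).2) :
    CycleCode (cycleMatroid G) e (endsCode p) := by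
  rw [cycleMatroid_eq_vectorMatroid]
  have := cycleCode_vectorMatroid (incidenceVector G) he hE
  rwa [show incidenceVector G ∘ e = fun i => (Finsupp.single (p i).1 1 + Finsupp.single (p i).2 1 :
    α →₀ ZMod 2) from funext fun i => incidenceVector_eq (hp i)] at this

theorem cycleCode_graphOfEnds {n m : ℕ} (p : Fin m → Fin n × Fin n) :
    CycleCode (cycleMatroid (graphOfEnds p)) id (endsCode p) :=
  cycleCode_cycleMatroid _ Function.injective_id (by simp [graphOfEnds]) p fun _ => rfl

/-- The ends of the `i`-th edge of `K_{3,3}`. -/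
def endsK33 (i : Fin 9) : (Fin 3 ⊕ Fin 3) × (Fin 3 ⊕ Fin 3) :=
  (Sum.inl (Fin.divNat (n := 3) (m := 3) i), Sum.inr (Fin.modNat (n := 3) (m := 3) i))

theorem cycleCode_graphK33 :
    CycleCode (cycleMatroid graphK33) (fun i => s((endsK33 i).1, (endsK33 i).2))
      (endsCode endsK33) := by
  refine cycleCode_cycleMatroid _ (by decide) ?_ _ fun i => ⟨rfl, ?_⟩
  · ext x
    induction x with | _ a b
    simp only [graphK33, Graph.ofSimpleGraph, Set.mem_range, SimpleGraph.mem_edgeSet]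
    constructor
    · rintro ⟨i, hi⟩
      rw [← SimpleGraph.mem_edgeSet, ← hi]
      simp [endsK33]
    · rcases a with a | a <;> rcases b with b | b <;> simp only [completeBipartiteGraph_adj] <;>
        revert a b <;> decide
  · simp [endsK33]

/-- A code is graphic if it is the cycle space of a finite multigraph. -/
theorem CycleCode.exists_ends {ι α : Type*} [Fintype ι] {M : Matroid α} {e : ι → α}
    {K : Submodule (ZMod 2) (ι → ZMod 2)} (h : CycleCode M e K) (hM : IsGraphic M) :
    ∃ (n : ℕ) (p : ι → Fin n × Fin n), K = endsCode p := by
  obtain ⟨n, m, G, hi⟩ := hM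
  obtain ⟨e', h'⟩ := h.exists_of_isIso hi
  have hl : ∀ i, ∃ p : Fin n × Fin n, G.IsLink (e' i) p.1 p.2 := fun i => by
    obtain ⟨u, v, huv⟩ := Graph.exists_isLink_of_mem_edgeSet (h'.mem_ground i)
    exact ⟨(u, v), huv⟩
  choose p hp using hl
  exact ⟨n, p, h'.unique (cycleCode_cycleMatroid G h'.inj h'.range_eq p hp)⟩

/-! ### Element splitting -/

theorem CycleCode.matroid_eq {ι β : Type*} {N N' : Matroid β} {e : ι → β}
    {K : Submodule (ZMod 2) (ι → ZMod 2)} (h : CycleCode N e K) (h' : CycleCode N' e K) :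
    N = N' := by
  refine Matroid.ext_indep (by rw [← h.range_eq, h'.range_eq]) fun I hI => ?_
  obtain ⟨J, rfl⟩ := h.exists_eq_image hI
  rw [h.indep_iff, h'.indep_iff]

/-- The cycle space of the element splitting matroid with respect to the elements labelled `i` and
`k`; the new element is labelled `none`. -/
def splitCode {ι : Type*} (K : Submodule (ZMod 2) (ι → ZMod 2)) (i k : ι) :
    Submodule (ZMod 2) (Option ι → ZMod 2) where
  carrier := {c | c ∘ some ∈ K ∧ c none = c (some i) + c (some k)}
  add_mem' := by
    rintro c d ⟨hc, hc'⟩ ⟨hd, hd'⟩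
    refine ⟨K.add_mem hc hd, ?_⟩
    simp only [Pi.add_apply, hc', hd']
    ring
  zero_mem' := ⟨K.zero_mem, by simp⟩
  smul_mem' := by
    rintro a c ⟨hc, hc'⟩
    refine ⟨K.smul_mem a hc, ?_⟩
    simp only [Pi.smul_apply, smul_eq_mul, hc']
    ring

theorem mem_splitCode {ι : Type*} {K : Submodule (ZMod 2) (ι → ZMod 2)} {i k : ι}
    {c : Option ι → ZMod 2} :
    c ∈ splitCode K i k ↔ c ∘ some ∈ K ∧ c none = c (some i) + c (some k) := Iff.rfl

/-- The old rows say that the restriction to the old columns is a relation of `A`; the new row is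
the equation `c none + c (some i) + c (some k) = 0`. The indices must differ, since `{e i, e k}` is
a set and would otherwise give a single entry 1. -/
theorem cycleCode_matrixMatroid_splittingMatrix {ρ ι α : Type*} [Fintype ι] {E : Set α}
    {A : Matrix ρ α (ZMod 2)} {e : ι → α} {K : Submodule (ZMod 2) (ι → ZMod 2)} {i k : ι}
    (h : CycleCode (matrixMatroid E A) e K) (hik : i ≠ k) :
    CycleCode (matrixMatroid (insert none (some '' E)) (splittingMatrix A {e i, e k}))
      (Option.map e) (splitCode K i k) := by
  classical
  have hE : Set.range e = E := h.range_eq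
  have hE' : Set.range (Option.map e) = insert none (some '' E) := by
    rw [← hE]
    ext x
    cases x <;> simp [Option.exists]
  have hK : K = relations (A.col ∘ e) := h.unique (cycleCode_vectorMatroid _ h.inj hE)
  have key := cycleCode_vectorMatroid (splittingMatrix A {e i, e k}).col
    (Option.map_injective h.inj) hE'
  suffices hs : splitCode K i k =
      relations ((splittingMatrix A {e i, e k}).col ∘ Option.map e) by
    rw [hs]
    exact key
  ext c
  rw [mem_splitCode, hK, mem_relations, mem_relations, Fintype.sum_option, funext_iff, funext_iff,
    Option.forall, and_comm]
  have hsum : ∑ l, c (some l) * (if l = i ∨ l = k then 1 else 0) = c (some i) + c (some k) := by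
    have h1 : ∀ l, c (some l) * (if l = i ∨ l = k then 1 else 0) =
        (if l = i then c (some l) else 0) + (if l = k then c (some l) else 0) := by
      intro l
      by_cases hl : l = i
      · subst hl; simp [hik]
      · simp [hl]
    simp [h1, Finset.sum_add_distrib]
  have hrow : (c none • (splittingMatrix A {e i, e k}).col (Option.map e none) + ∑ l, c (some l) •
      (splittingMatrix A {e i, e k}).col (Option.map e (some l))) none =
      c none + (c (some i) + c (some k)) := by
    rw [← hsum]
    simp [Matrix.col_apply, splittingMatrix, Finset.sum_apply, h.inj.eq_iff]
  refine and_congr ?_ (forall_congr' fun r => ?_)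
  · simp only [Function.comp_apply]
    rw [hrow]
    constructor
    · intro h0
      rw [h0, zmod_two_add_self]; rfl
    · intro h0
      rw [← sub_eq_zero, CharTwo.sub_eq_add]
      exact h0
  · simp [Matrix.col_apply, splittingMatrix, Finset.sum_apply]

theorem IsElementSplitting.cycleCode {ι α : Type*} [Fintype ι] {M : Matroid α} {e : ι → α}
    {K : Submodule (ZMod 2) (ι → ZMod 2)} {i k : ι} {M' : Matroid (Option α)}
    (hM' : IsElementSplitting M {e i, e k} M') (h : CycleCode M e K) (hik : i ≠ k) :
    CycleCode M' (Option.map e) (splitCode K i k) := by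
  obtain ⟨m, A, hA, rfl⟩ := hM'
  rw [hA] at h
  exact cycleCode_matrixMatroid_splittingMatrix h hik

/-- The incidence matrix of the graph represents the matroid; columns outside the ground set are
filled with zeros. -/
theorem CycleCode.exists_isElementSplitting {ι α : Type*} [Fintype ι] {M : Matroid α} {e : ι → α}
    {n : ℕ} {p : ι → Fin n × Fin n} (h : CycleCode M e (endsCode p)) (X : Set α) :
    ∃ M', IsElementSplitting M X M' := by
  classical
  let A : Matrix (Fin n) α (ZMod 2) := fun v b =>
    Function.extend e (fun i => (Finsupp.single (p i).1 1 + Finsupp.single (p i).2 1 :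
      Fin n →₀ ZMod 2)) 0 b v
  refine ⟨_, n, A, ?_, rfl⟩
  have h1 : CycleCode (matrixMatroid M.E A) e (relations (A.col ∘ e)) :=
    cycleCode_vectorMatroid _ h.inj h.range_eq
  refine h.matroid_eq ?_
  convert h1 using 1
  ext c
  rw [endsCode, mem_relations, mem_relations, Finsupp.ext_iff, funext_iff]
  refine forall_congr' fun v => ?_
  have hA : ∀ i, A.col (e i) v = (Finsupp.single (p i).1 1 + Finsupp.single (p i).2 1 :
      Fin n →₀ ZMod 2) v := fun i => by
    rw [Matrix.col_apply]
    exact DFunLike.congr_fun (h.inj.extend_apply (fun i => (Finsupp.single (p i).1 1 +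
      Finsupp.single (p i).2 1 : Fin n →₀ ZMod 2)) 0 i) v
  simp only [Finsupp.finsetSum_apply, Finset.sum_apply, Pi.smul_apply, Function.comp_apply, hA,
    Finsupp.smul_apply, Finsupp.zero_apply, Pi.zero_apply]

/-! ### Vertex stars -/

/-- The matroid with cycle space `K` has no loops, no coloops and no two elements in series. -/
structure IsThick {ι : Type*} [DecidableEq ι] (K : Submodule (ZMod 2) (ι → ZMod 2)) : Prop where
  single_notMem : ∀ i, Pi.single i 1 ∉ K
  exists_ne_zero : ∀ i, ∃ c ∈ K, c i ≠ 0
  exists_ne : ∀ i k, i ≠ k → ∃ c ∈ K, c i ≠ c k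

/-- A vector orthogonal to all cycles is a cocycle: weight one would make its element a coloop, and
weight two would make its two elements agree on all cycles. -/
theorem IsThick.three_le_card {ι : Type*} [DecidableEq ι] [Fintype ι]
    {K : Submodule (ZMod 2) (ι → ZMod 2)} (hK : IsThick K) {d : ι → ZMod 2} (hd : d ≠ 0)
    (horth : ∀ c ∈ K, ∑ i, c i * d i = 0) : 3 ≤ (Finset.univ.filter fun i => d i ≠ 0).card := by
  by_contra! hlt
  have hsum : ∀ c ∈ K, ∑ i ∈ Finset.univ.filter (fun i => d i ≠ 0), c i = 0 := by
    intro c hc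
    rw [Finset.sum_filter]
    refine (Finset.sum_congr rfl fun i _ => ?_).trans (horth c hc)
    rcases zmod_two_cases (d i) with h | h <;> simp [h]
  interval_cases hcard : (Finset.univ.filter fun i => d i ≠ 0).card
  · rw [Finset.card_eq_zero, Finset.filter_eq_empty_iff] at hcard
    exact hd (funext fun i => not_not.1 (hcard (Finset.mem_univ i)))
  · obtain ⟨i, hi⟩ := Finset.card_eq_one.1 hcard
    obtain ⟨c, hc, h0⟩ := hK.exists_ne_zero i
    have := hsum c hc
    rw [hi, Finset.sum_singleton] at this
    exact h0 this
  · obtain ⟨i, k, hik, hi⟩ := Finset.card_eq_two.1 hcard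
    obtain ⟨c, hc, h0⟩ := hK.exists_ne i k hik
    have := hsum c hc
    rw [hi, Finset.sum_pair hik] at this
    exact h0 (by rwa [← sub_eq_zero, CharTwo.sub_eq_add])

/-- The star of the vertex `v`. -/
def star {ι V : Type*} [DecidableEq V] (p : ι → V × V) (v : V) (i : ι) : ZMod 2 :=
  (if (p i).1 = v then 1 else 0) + (if (p i).2 = v then 1 else 0)

section

variable {ι V : Type*} [DecidableEq V] {p : ι → V × V}

theorem mem_endsCode_iff_star [Fintype ι] {c : ι → ZMod 2} :
    c ∈ endsCode p ↔ ∀ v, ∑ i, c i * star p v i = 0 := mem_endsCode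

theorem ends_ne [Fintype ι] [DecidableEq ι] (hK : ∀ i, Pi.single i 1 ∉ endsCode p) (i : ι) :
    (p i).1 ≠ (p i).2 := by
  intro h
  refine hK i (mem_endsCode_iff_star.2 fun v => ?_)
  rw [Finset.sum_eq_single i (fun k _ hk => by rw [Pi.single_eq_of_ne hk, zero_mul]) (by simp)]
  rw [star, h, zmod_two_add_self, mul_zero]

theorem star_ne_zero_iff {i : ι} (h : (p i).1 ≠ (p i).2) (v : V) :
    star p v i ≠ 0 ↔ v = (p i).1 ∨ v = (p i).2 := by
  unfold star
  by_cases h1 : (p i).1 = v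
  · subst h1; simp [h.symm]
  · by_cases h2 : (p i).2 = v
    · subst h2; simp [h]
    · simp [h1, h2, Ne.symm h1, Ne.symm h2]

variable [Fintype V]

theorem card_star_ne_zero {i : ι} (h : (p i).1 ≠ (p i).2) :
    (Finset.univ.filter fun v => star p v i ≠ 0).card = 2 := by
  have : (Finset.univ.filter fun v => star p v i ≠ 0) = {(p i).1, (p i).2} := by
    ext v
    simp only [Finset.mem_filter, Finset.mem_univ, true_and, star_ne_zero_iff h,
      Finset.mem_insert, Finset.mem_singleton]
  rw [this, Finset.card_pair h]

theorem sum_star (i : ι) : ∑ v, star p v i = 0 := by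
  simp only [star, Finset.sum_add_distrib, Finset.sum_ite_eq, Finset.mem_univ, if_true]
  rfl

/-- A graph with non-empty edge set and cycle space `K` has at least `|E| - dim K + 1` vertices
that meet an edge. -/
theorem card_lt_finrank_add_card_star [Fintype ι] [Nonempty ι]
    (h : ∀ i, (p i).1 ≠ (p i).2) :
    Fintype.card ι < Module.finrank (ZMod 2) (endsCode p) +
      (Finset.univ.filter fun v => star p v ≠ 0).card := by
  classical
  obtain ⟨i⟩ := ‹Nonempty ι›
  have h0 : star p (p i).1 ≠ 0 := fun h0 =>
    (star_ne_zero_iff (h i) _).2 (Or.inl rfl) (congrFun h0 i)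
  -- The stars add up to zero, so the equation at one vertex follows from the others and can be
  -- dropped. This gives the strict inequality.
  let W := (Finset.univ.filter fun v => star p v ≠ 0).erase (p i).1
  let Φ : (ι → ZMod 2) →ₗ[ZMod 2] (W → ZMod 2) :=
    LinearMap.pi fun v => Fintype.linearCombination (ZMod 2) (star p v)
  have hΦ : ∀ c v, Φ c v = ∑ i, c i * star p v i := fun c v => by
    simp [Φ, Fintype.linearCombination_apply]
  have hker : LinearMap.ker Φ = endsCode p := by
    ext c
    rw [LinearMap.mem_ker, mem_endsCode_iff_star]
    constructor
    · intro hc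
      have hne : ∀ v ≠ (p i).1, ∑ i, c i * star p v i = 0 := by
        intro v hv
        by_cases hs : star p v = 0
        · simp [hs]
        · have hvW : v ∈ W := Finset.mem_erase.2 ⟨hv, by simpa using hs⟩
          rw [← hΦ c ⟨v, hvW⟩, hc]; rfl
      intro v
      by_cases hv : v = (p i).1
      · have htot : ∑ v, ∑ i, c i * star p v i = 0 := by
          rw [Finset.sum_comm]
          simp only [← Finset.mul_sum, sum_star, mul_zero, Finset.sum_const_zero]
        rw [Finset.sum_eq_single v (fun u _ hu => hne u (hv ▸ hu)) (by simp)] at htot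
        exact htot
      · exact hne v hv
    · intro hc
      funext v
      rw [hΦ]; exact hc v
  have hrn := LinearMap.finrank_range_add_finrank_ker Φ
  have hle := Submodule.finrank_le (LinearMap.range Φ)
  rw [hker, Module.finrank_fintype_fun_eq_card] at hrn
  rw [Module.finrank_fintype_fun_eq_card, Fintype.card_coe] at hle
  have hW : W.card + 1 = (Finset.univ.filter fun v => star p v ≠ 0).card :=
    Finset.card_erase_add_one (by simpa using h0)
  omega

/-- The handshake lemma: without loops every edge lies in exactly two stars. -/
theorem sum_card_star [Fintype ι] (h : ∀ i, (p i).1 ≠ (p i).2) :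
    ∑ v ∈ Finset.univ.filter (fun v => star p v ≠ 0),
      (Finset.univ.filter fun i => star p v i ≠ 0).card = 2 * Fintype.card ι := by
  have h1 : ∑ v ∈ Finset.univ.filter (fun v => star p v ≠ 0),
      (Finset.univ.filter fun i => star p v i ≠ 0).card =
      ∑ v, (Finset.univ.filter fun i => star p v i ≠ 0).card := by
    refine Finset.sum_subset (Finset.subset_univ _) fun v _ hv => ?_
    have : star p v = 0 := by simpa using hv
    simp [this]
  rw [h1]
  simp only [Finset.card_filter]
  rw [Finset.sum_comm]
  simp only [← Finset.card_filter, card_star_ne_zero (h _)]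
  simp [mul_comm]

end

/-! ### Vectors over `GF(2)` as bit masks -/

/-- The `i`-th binary digit of `n`. -/
def bit (n i : ℕ) : Bool := Nat.beq (Nat.land (Nat.shiftRight n i) 1) 1

theorem bit_eq_testBit (n i : ℕ) : bit n i = n.testBit i := by
  have h : Nat.land (Nat.shiftRight n i) 1 = (n >>> i) % 2 := Nat.and_one_is_mod _
  rw [bit, h, Nat.testBit_eq_decide_div_mod_eq, Nat.shiftRight_eq_div_pow]
  rcases Nat.mod_two_eq_zero_or_one (n / 2 ^ i) with h | h <;> rw [h] <;> rfl

theorem bit_xor (a b i : ℕ) : bit (Nat.xor a b) i = xor (bit a i) (bit b i) := by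
  simp only [bit_eq_testBit]; exact Nat.testBit_xor a b i

theorem bit_land (a b i : ℕ) : bit (Nat.land a b) i = (bit a i && bit b i) := by
  simp only [bit_eq_testBit]; exact Nat.testBit_and a b i

theorem bit_lor (a b i : ℕ) : bit (Nat.lor a b) i = (bit a i || bit b i) := by
  simp only [bit_eq_testBit]; exact Nat.testBit_or a b i

theorem bit_zero (i : ℕ) : bit 0 i = false := by
  rw [bit_eq_testBit, Nat.zero_testBit]

theorem eq_of_bit_eq {m a b : ℕ} (ha : a < 2 ^ m) (hb : b < 2 ^ m)
    (h : ∀ i < m, bit a i = bit b i) : a = b := by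
  refine Nat.eq_of_testBit_eq fun i => ?_
  by_cases hi : i < m
  · rw [← bit_eq_testBit, ← bit_eq_testBit, h i hi]
  · have h2 : 2 ^ m ≤ 2 ^ i := Nat.pow_le_pow_right (by norm_num) (by omega)
    rw [Nat.testBit_lt_two_pow (ha.trans_le h2), Nat.testBit_lt_two_pow (hb.trans_le h2)]

/-- The parity of the number of ones among the first `m` binary digits of `n`. -/
def parity : ℕ → ℕ → Bool
  | 0, _ => false
  | m + 1, n => xor (parity m n) (bit n m)

/-- The number of ones among the first `m` binary digits of `n`. -/
def weight : ℕ → ℕ → ℕ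
  | 0, _ => 0
  | m + 1, n => bif bit n m then Nat.succ (weight m n) else weight m n

theorem parity_xor_land (m a b c : ℕ) : parity m (Nat.land (Nat.xor a b) c) =
    xor (parity m (Nat.land a c)) (parity m (Nat.land b c)) := by
  induction m with
  | zero => rfl
  | succ m ih =>
    simp only [parity, ih, bit_land, bit_xor]
    cases bit a m <;> cases bit b m <;> cases bit c m <;>
      cases parity m (Nat.land a c) <;> cases parity m (Nat.land b c) <;> rfl

/-- The vector of the first `m` binary digits of `n`. -/
def dec (m n : ℕ) (i : Fin m) : ZMod 2 := bif bit n i then 1 else 0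

/-- The bit mask of a vector over `GF(2)`. -/
def enc {m : ℕ} (c : Fin m → ZMod 2) : ℕ := Nat.ofBits fun i => decide (c i = 1)

theorem enc_lt {m : ℕ} (c : Fin m → ZMod 2) : enc c < 2 ^ m := Nat.ofBits_lt_two_pow _

theorem bit_enc {m : ℕ} (c : Fin m → ZMod 2) (i : Fin m) : bit (enc c) i = decide (c i = 1) := by
  rw [bit_eq_testBit, enc, Nat.testBit_ofBits_lt _ _ i.2]

theorem dec_enc {m : ℕ} (c : Fin m → ZMod 2) : dec m (enc c) = c := by
  funext i
  rw [dec, bit_enc]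
  rcases zmod_two_cases (c i) with h | h <;> rw [h] <;> rfl

theorem dec_xor (m a b : ℕ) : dec m (Nat.xor a b) = dec m a + dec m b := by
  funext i
  simp only [dec, Pi.add_apply, bit_xor]
  cases bit a i <;> cases bit b i <;> rfl

theorem dec_zero (m : ℕ) : dec m 0 = 0 := by
  funext i
  simp [dec, bit_zero]

theorem sum_dec_mul_dec (m a b : ℕ) :
    ∑ i, dec m a i * dec m b i = bif parity m (Nat.land a b) then 1 else 0 := by
  induction m with
  | zero => rfl
  | succ m ih =>
    have h1 : ∀ (n : ℕ) (i : Fin m), dec (m + 1) n i.castSucc = dec m n i := fun _ _ => rfl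
    have h2 : ∀ n, dec (m + 1) n (Fin.last m) = bif bit n m then 1 else 0 := fun _ => rfl
    rw [Fin.sum_univ_castSucc]
    simp only [h1, h2, ih, parity, bit_land]
    cases bit a m <;> cases bit b m <;> cases parity m (Nat.land a b) <;> rfl

theorem parity_enc {m g : ℕ} {c : Fin m → ZMod 2} (h : ∑ i, c i * dec m g i = 0) :
    parity m (Nat.land (enc c) g) = false := by
  have h1 := sum_dec_mul_dec m (enc c) g
  rw [dec_enc, h] at h1
  cases hp : parity m (Nat.land (enc c) g)
  · rfl
  · rw [hp] at h1; exact absurd h1 (by decide)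

theorem weight_eq (m n : ℕ) : weight m n = (Finset.univ.filter fun i => dec m n i ≠ 0).card := by
  induction m with
  | zero => rfl
  | succ m ih =>
    have h1 : ∀ (n : ℕ) (i : Fin m), dec (m + 1) n i.castSucc = dec m n i := fun _ _ => rfl
    have h2 : ∀ n, dec (m + 1) n (Fin.last m) = bif bit n m then 1 else 0 := fun _ => rfl
    rw [Finset.card_filter, Fin.sum_univ_castSucc]
    simp only [h1, h2, weight, ih, ← Finset.card_filter]
    cases bit n m <;> simp

theorem weight_enc {m : ℕ} (c : Fin m → ZMod 2) :
    weight m (enc c) = (Finset.univ.filter fun i => c i ≠ 0).card := by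
  rw [weight_eq, dec_enc]

/-! ### Spans and orthogonal complements -/

/-- The sums of the sublists of a list of masks. -/
def spanList : List ℕ → List ℕ
  | [] => [0]
  | b :: l => spanList l ++ (spanList l).map (Nat.xor b)

theorem mem_spanList_cons {b n : ℕ} {l : List ℕ} :
    n ∈ spanList (b :: l) ↔ n ∈ spanList l ∨ ∃ k ∈ spanList l, Nat.xor b k = n := by
  simp [spanList]

theorem zero_mem_spanList (l : List ℕ) : 0 ∈ spanList l := by
  induction l with
  | nil => simp [spanList]
  | cons b l ih => exact mem_spanList_cons.2 (Or.inl ih)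

theorem mem_spanList_map {f : ℕ → ℕ} (h0 : f 0 = 0)
    (hf : ∀ a b, f (Nat.xor a b) = Nat.xor (f a) (f b)) {l : List ℕ} {n : ℕ} :
    n ∈ spanList (l.map f) ↔ ∃ k ∈ spanList l, f k = n := by
  induction l generalizing n with
  | nil => simp [spanList, h0, eq_comm]
  | cons b l ih =>
    rw [List.map_cons, mem_spanList_cons, ih]
    constructor
    · rintro (⟨k, hk, rfl⟩ | ⟨k, hk, rfl⟩)
      · exact ⟨k, mem_spanList_cons.2 (Or.inl hk), rfl⟩
      · obtain ⟨k', hk', rfl⟩ := ih.1 hk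
        exact ⟨_, mem_spanList_cons.2 (Or.inr ⟨k', hk', rfl⟩), hf _ _⟩
    · rintro ⟨k, hk, rfl⟩
      rcases mem_spanList_cons.1 hk with hk | ⟨k', hk', rfl⟩
      · exact Or.inl ⟨k, hk, rfl⟩
      · exact Or.inr ⟨f k', ih.2 ⟨k', hk', rfl⟩, (hf _ _).symm⟩

/-- One step of the computation of an orthogonal complement: a list spanning the vectors that are
orthogonal to `g` in the span of a list. -/
def perpStep (m g : ℕ) : List ℕ → List ℕ
  | [] => []
  | b :: l => bif parity m (Nat.land b g) then
      l.map fun c => bif parity m (Nat.land c g) then Nat.xor c b else c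
    else b :: perpStep m g l

/-- A list of masks spanning the orthogonal complement of the span of a list of masks. -/
def perpBasis (m : ℕ) (gens : List ℕ) : List ℕ :=
  gens.foldr (perpStep m) ((List.range m).map (2 ^ ·))

theorem nat_xor_comm (a b : ℕ) : Nat.xor a b = Nat.xor b a := Nat.xor_comm a b

/-- At the first `b` not orthogonal to `g`, replacing `c` by `c + b` whenever `c` is not orthogonal
to `g` is a linear map. It kills `b` and fixes every vector orthogonal to `g`. -/
theorem mem_spanList_perpStep {m g : ℕ} {l : List ℕ} {d : ℕ} (hd : d ∈ spanList l)
    (hp : parity m (Nat.land d g) = false) : d ∈ spanList (perpStep m g l) := by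
  induction l generalizing d with
  | nil => exact hd
  | cons b l ih =>
    cases hb : parity m (Nat.land b g)
    · have heq : perpStep m g (b :: l) = b :: perpStep m g l := by
        rw [perpStep, hb, cond_false]
      rw [heq, mem_spanList_cons]
      rcases mem_spanList_cons.1 hd with hd | ⟨k, hk, rfl⟩
      · exact Or.inl (ih hd hp)
      · rw [parity_xor_land, hb, Bool.false_xor] at hp
        exact Or.inr ⟨k, ih hk hp, rfl⟩
    · let f : ℕ → ℕ := fun c => bif parity m (Nat.land c g) then Nat.xor c b else c
      have heq : perpStep m g (b :: l) = l.map f := by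
        rw [perpStep, hb, cond_true]
      have hpar0 : parity m (Nat.land 0 g) = false := by
        have h := parity_xor_land m 0 0 g
        rw [show Nat.xor 0 0 = 0 from rfl, Bool.xor_self] at h
        exact h
      have h0 : f 0 = 0 := by simp only [f, hpar0, cond_false]
      have hf : ∀ x y, f (Nat.xor x y) = Nat.xor (f x) (f y) := by
        intro x y
        simp only [f, parity_xor_land]
        refine Nat.eq_of_testBit_eq fun i => ?_
        cases parity m (Nat.land x g) <;> cases parity m (Nat.land y g) <;>
          simp only [Bool.xor_false, Bool.xor_true, Bool.not_false, Bool.not_true, cond_true,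
            cond_false, ← bit_eq_testBit, bit_xor] <;>
          cases bit x i <;> cases bit y i <;> cases bit b i <;> rfl
      rw [heq, mem_spanList_map h0 hf]
      rcases mem_spanList_cons.1 hd with hd | ⟨k, hk, rfl⟩
      · exact ⟨d, hd, by simp only [f, hp, cond_false]⟩
      · rw [parity_xor_land, hb, Bool.true_xor, Bool.not_eq_false'] at hp
        exact ⟨k, hk, by simp only [f, hp, cond_true]; exact nat_xor_comm _ _⟩

theorem mem_spanList_two_pow {m d : ℕ} (hd : d < 2 ^ m) :
    d ∈ spanList ((List.range m).map (2 ^ ·)) := by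
  -- With the list reversed, the induction on `m` peels off the top digit; `hperm` restores the
  -- order.
  have key : ∀ m (d : ℕ), d < 2 ^ m → d ∈ spanList ((List.range m).reverse.map (2 ^ ·)) := by
    intro m
    induction m with
    | zero => intro d hd; simp [spanList]; omega
    | succ m ih =>
      intro d hd
      rw [List.range_succ, List.reverse_append, List.reverse_singleton, List.singleton_append,
        List.map_cons, mem_spanList_cons]
      by_cases h : d < 2 ^ m
      · exact Or.inl (ih d h)
      · refine Or.inr ⟨d ^^^ 2 ^ m, ih _ ?_, ?_⟩
        · refine Nat.lt_pow_two_of_testBit _ fun i hi => ?_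
          rw [Nat.testBit_xor, Nat.testBit_two_pow]
          by_cases him : m = i
          · subst him
            have : d.testBit m = true := by
              rw [Nat.testBit_eq_decide_div_mod_eq]
              have : d / 2 ^ m = 1 := by
                rw [pow_succ] at hd
                exact Nat.div_eq_of_lt_le (by omega) (by omega)
              simp [this]
            simp [this]
          · have h2 : 2 ^ (m + 1) ≤ 2 ^ i := Nat.pow_le_pow_right (by norm_num) (by omega)
            simp [Nat.testBit_lt_two_pow (hd.trans_le h2), him]
        · change 2 ^ m ^^^ (d ^^^ 2 ^ m) = d
          rw [Nat.xor_comm, Nat.xor_assoc, Nat.xor_self, Nat.xor_zero]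
  have hperm : ∀ l l' : List ℕ, l.Perm l' → ∀ n, n ∈ spanList l → n ∈ spanList l' := by
    intro l l' h
    induction h with
    | nil => exact fun n h => h
    | cons b _ ih =>
      intro n hn
      rcases mem_spanList_cons.1 hn with hn | ⟨k, hk, rfl⟩
      · exact mem_spanList_cons.2 (Or.inl (ih n hn))
      · exact mem_spanList_cons.2 (Or.inr ⟨k, ih k hk, rfl⟩)
    | swap a b l =>
      intro n hn
      simp only [mem_spanList_cons] at hn ⊢
      rcases hn with (hn | ⟨k, hk, rfl⟩) | ⟨k, hk | ⟨k', hk', rfl⟩, rfl⟩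
      · exact Or.inl (Or.inl hn)
      · exact Or.inr ⟨k, Or.inl hk, rfl⟩
      · exact Or.inl (Or.inr ⟨k, hk, rfl⟩)
      · exact Or.inr ⟨_, Or.inr ⟨k', hk', rfl⟩, Nat.xor_left_comm _ _ _⟩
    | trans _ _ ih1 ih2 => exact fun n hn => ih2 n (ih1 n hn)
  exact hperm _ _ ((List.reverse_perm _).map _) d (key m d hd)

theorem mem_spanList_perpBasis {m : ℕ} {gens : List ℕ} {d : ℕ} (hd : d < 2 ^ m)
    (h : ∀ g ∈ gens, parity m (Nat.land d g) = false) : d ∈ spanList (perpBasis m gens) := by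
  induction gens with
  | nil => exact mem_spanList_two_pow hd
  | cons g gens ih =>
    exact mem_spanList_perpStep (ih fun g' hg' => h g' (List.mem_cons_of_mem _ hg'))
      (h g List.mem_cons_self)

/-- The space of vectors spanned by a list of masks. -/
def maskCode (m : ℕ) (gens : List ℕ) : Submodule (ZMod 2) (Fin m → ZMod 2) :=
  Submodule.span (ZMod 2) {c | ∃ g ∈ gens, dec m g = c}

theorem mem_maskCode {m : ℕ} {gens : List ℕ} {c : Fin m → ZMod 2} :
    c ∈ maskCode m gens ↔ ∃ n ∈ spanList gens, dec m n = c := by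
  constructor
  · intro hc
    have key : ∀ l : List ℕ, ∀ a ∈ spanList l, ∀ b ∈ spanList l, Nat.xor a b ∈ spanList l := by
      intro l
      induction l with
      | nil =>
        intro a ha b hb
        simp only [spanList, List.mem_singleton] at *
        rw [ha, hb]; rfl
      | cons g l ih =>
        intro a ha b hb
        rcases mem_spanList_cons.1 ha with ha' | ⟨a, ha', rfl⟩ <;>
          rcases mem_spanList_cons.1 hb with hb' | ⟨b, hb', rfl⟩
        · exact mem_spanList_cons.2 (Or.inl (ih a ha' b hb'))
        · exact mem_spanList_cons.2 (Or.inr ⟨_, ih a ha' b hb', Nat.xor_left_comm _ _ _⟩)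
        · exact mem_spanList_cons.2 (Or.inr ⟨_, ih a ha' b hb', (Nat.xor_assoc _ _ _).symm⟩)
        · refine mem_spanList_cons.2 (Or.inl ?_)
          have : Nat.xor (Nat.xor g a) (Nat.xor g b) = Nat.xor a b := by
            change g ^^^ a ^^^ (g ^^^ b) = a ^^^ b
            rw [Nat.xor_comm g a, Nat.xor_assoc, ← Nat.xor_assoc g g, Nat.xor_self, Nat.zero_xor]
          rw [this]
          exact ih a ha' b hb'
    refine Submodule.span_induction ?_ ?_ ?_ ?_ hc
    · rintro _ ⟨g, hg, rfl⟩
      refine ⟨g, ?_, rfl⟩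
      clear hc c
      induction gens with
      | nil => simp at hg
      | cons b l ih =>
        rcases List.mem_cons.1 hg with rfl | hg
        · exact mem_spanList_cons.2 (Or.inr ⟨0, zero_mem_spanList l, Nat.xor_zero _⟩)
        · exact mem_spanList_cons.2 (Or.inl (ih hg))
    · exact ⟨0, zero_mem_spanList _, dec_zero m⟩
    · rintro _ _ - - ⟨a, ha, rfl⟩ ⟨b, hb, rfl⟩
      exact ⟨_, key _ a ha b hb, dec_xor m a b⟩
    · rintro r _ - ⟨a, ha, rfl⟩
      rcases zmod_two_cases r with rfl | rfl
      · exact ⟨0, zero_mem_spanList _, by rw [zero_smul, dec_zero]⟩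
      · exact ⟨a, ha, (one_smul _ _).symm⟩
  · rintro ⟨n, hn, rfl⟩
    induction gens generalizing n with
    | nil =>
      simp only [spanList, List.mem_singleton] at hn
      rw [hn, dec_zero]
      exact Submodule.zero_mem _
    | cons b l ih =>
      have hle : maskCode m l ≤ maskCode m (b :: l) := by
        refine Submodule.span_mono ?_
        rintro _ ⟨g, hg, rfl⟩
        exact ⟨g, List.mem_cons_of_mem _ hg, rfl⟩
      rcases mem_spanList_cons.1 hn with hn | ⟨k, hk, rfl⟩
      · exact hle (ih n hn)
      · rw [dec_xor]
        exact Submodule.add_mem _ (Submodule.subset_span ⟨b, List.mem_cons_self, rfl⟩)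
          (hle (ih k hk))

theorem dec_mem_maskCode {m g : ℕ} {gens : List ℕ} (hg : g ∈ gens) : dec m g ∈ maskCode m gens :=
  Submodule.subset_span ⟨g, hg, rfl⟩

theorem finrank_maskCode_le (m : ℕ) (gens : List ℕ) :
    Module.finrank (ZMod 2) (maskCode m gens) ≤ gens.length := by
  classical
  have h : {c | ∃ g ∈ gens, dec m g = c} = ((gens.toFinset.image (dec m) : Finset _) : Set _) := by
    ext c; simp
  rw [maskCode, h]
  exact (finrank_span_finset_le_card _).trans
    (Finset.card_image_le.trans (List.toFinset_card_le _))

/-- The cycle space of a graph is computed as the orthogonal complement of the vertex stars. -/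
theorem endsCode_eq_maskCode {m : ℕ} {V : Type*} [DecidableEq V] {p : Fin m → V × V} (vs : List V)
    {gens : List ℕ} (h1 : ∀ v, ∀ g ∈ gens, ∑ i, dec m g i * star p v i = 0)
    (h2 : perpBasis m (vs.map fun v => enc (star p v)) = gens) :
    endsCode p = maskCode m gens := by
  -- The list `vs` need not contain all vertices: orthogonality to some stars already bounds the
  -- cycle space from above, while `h1` tests the generators at every vertex.
  apply le_antisymm
  · intro c hc
    rw [mem_endsCode_iff_star] at hc
    refine mem_maskCode.2 ⟨enc c, ?_, dec_enc c⟩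
    rw [← h2]
    refine mem_spanList_perpBasis (enc_lt c) fun g hg => ?_
    obtain ⟨v, -, rfl⟩ := List.mem_map.1 hg
    exact parity_enc (by rw [dec_enc]; exact hc v)
  · refine Submodule.span_le.2 ?_
    rintro _ ⟨g, hg, rfl⟩
    exact mem_endsCode_iff_star.2 fun v => h1 v g hg

/-! ### Searching for vertex stars -/

/-- Search for a family of at least `need` members of `cands` of weight at least three and of total
weight at most `cap`, which together with the elements that are already covered once (`one`) and
twice (`two`) covers each of the `m` elements exactly twice, the elements before `i` being settled.
The result is `false` only if there is no such family. -/
def search (m : ℕ) (cands : List ℕ) : ℕ → ℕ → ℕ → ℕ → ℕ → ℕ → Bool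
  | 0, _, _, _, _, _ => true
  | f + 1, i, need, cap, one, two =>
    -- Prune when the required stars, of weight at least three each, exceed the remaining total
    -- weight. The other branches stay at `i` until it is covered twice; running out of `f` counts
    -- as success, so only `false` carries information.
    bif Nat.ble (Nat.mul 3 need) cap then
      bif Nat.ble m i then true
      else bif bit two i then search m cands f (Nat.succ i) need cap one two
      else cands.any fun d => bif bit d i then
          bif Nat.beq (Nat.land d two) 0 then
            search m cands f i (Nat.pred need) (Nat.sub cap (weight m d)) (Nat.lor one d)
              (Nat.lor two (Nat.land one d))
          else false
        else false
    else false

/-- `L` is the list of stars not yet chosen. If `i` is not covered twice, some star in `L` contains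
it, and the branch choosing that star preserves all the invariants with `L` shortened by one. -/
theorem search_eq_true {m : ℕ} {cands : List ℕ} (f i need cap one two : ℕ) (L : List ℕ)
    (hL : ∀ d ∈ L, d ∈ cands ∧ d < 2 ^ m ∧ 3 ≤ weight m d)
    (hcap : (L.map (weight m)).sum ≤ cap) (hneed : need ≤ L.length)
    (hone : ∀ j < m, bit two j = true → bit one j = true)
    (hcov : ∀ j < m, L.countP (bit · j) + (bit one j).toNat + (bit two j).toNat = 2) :
    search m cands f i need cap one two = true := by
  induction f generalizing i need cap one two L with
  | zero => rfl
  | succ f ih =>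
    have h3 : 3 * L.length ≤ (L.map (weight m)).sum := by
      have := List.card_nsmul_le_sum (L.map (weight m)) 3 (by
        intro x hx
        obtain ⟨d, hd, rfl⟩ := List.mem_map.1 hx
        exact (hL d hd).2.2)
      simpa [mul_comm] using this
    have hble : Nat.ble (Nat.mul 3 need) cap = true :=
      Nat.ble_eq_true_of_le (show 3 * need ≤ cap by omega)
    rw [search, hble, cond_true]
    by_cases him : m ≤ i
    · rw [Nat.ble_eq_true_of_le him, cond_true]
    · have hble' : Nat.ble m i = false := by
        rw [← Bool.not_eq_true, Nat.ble_eq]; exact him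
      rw [hble', cond_false]
      cases htwo : bit two i
      · rw [cond_false, List.any_eq_true]
        have hc := hcov i (by omega)
        have hpos : 0 < L.countP (bit · i) := by
          rw [htwo] at hc
          have := Bool.toNat_le (bit one i)
          simp only [Bool.toNat_false] at hc
          omega
        obtain ⟨d, hdL, hdi⟩ := List.countP_pos_iff.1 hpos
        have hperm : L.Perm (d :: L.erase d) := List.perm_cons_erase hdL
        have hcnt : ∀ j, L.countP (bit · j) = (L.erase d).countP (bit · j) + (bit d j).toNat := by
          intro j
          rw [hperm.countP_eq, List.countP_cons]
          cases bit d j <;> rfl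
        have hdisj : ∀ j < m, bit d j = true → bit two j = false := by
          intro j hj hdj
          by_contra ht
          rw [Bool.not_eq_false] at ht
          have h1 := hcov j hj
          rw [hcnt, hdj, hone j hj ht, ht] at h1
          simp only [Bool.toNat_true] at h1
          omega
        have hland : Nat.land d two = 0 := by
          refine eq_of_bit_eq (m := m) (Nat.and_le_left.trans_lt (hL d hdL).2.1) (by positivity) ?_
          intro j hj
          rw [bit_land, bit_zero]
          cases hdj : bit d j
          · rfl
          · rw [hdisj j hj hdj]; rfl
        refine ⟨d, (hL d hdL).1, ?_⟩
        rw [hdi, cond_true, hland, Nat.beq_refl, cond_true]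
        have hsum : (L.map (weight m)).sum = weight m d + ((L.erase d).map (weight m)).sum := by
          rw [(hperm.map _).sum_eq, List.map_cons, List.sum_cons]
        have hlen : L.length = (L.erase d).length + 1 := by
          rw [hperm.length_eq, List.length_cons]
        refine ih _ _ _ _ _ (L.erase d) (fun d' hd' => hL d' (List.mem_of_mem_erase hd'))
          ?_ ?_ ?_ ?_
        · change _ ≤ cap - weight m d
          omega
        · rw [Nat.pred_eq_sub_one]; omega
        · intro j hj h
          rw [bit_lor, bit_land, Bool.or_eq_true, Bool.and_eq_true] at h
          rw [bit_lor, Bool.or_eq_true]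
          rcases h with h | ⟨-, h⟩
          · exact Or.inl (hone j hj h)
          · exact Or.inr h
        · intro j hj
          have h1 := hcov j hj
          rw [hcnt] at h1
          rw [bit_lor, bit_lor, bit_land]
          have h2 := hdisj j hj
          revert h1 h2
          generalize (L.erase d).countP (bit · j) = k
          cases bit d j <;> cases bit one j <;> cases bit two j <;> simp
      · rw [cond_true]
        exact ih _ _ _ _ _ L hL hcap hneed hone hcov

/-- A test for the matroids with a given list of generators of the cycle space: the result is
`false` only if the matroid has a cocycle with one or two elements or is not graphic. -/
def possiblyGraphic (m : ℕ) (gens : List ℕ) : Bool :=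
  let D := spanList (perpBasis m gens)
  -- A lower bound for the number of vertices meeting an edge, as the dimension of the cycle space
  -- is at most the number of generators.
  let need := Nat.succ (Nat.sub m gens.length)
  -- The clause on `gens.any` passes any vector that is not a cocycle. Thus it suffices that `D`
  -- contains all cocycles, and it need not be shown to contain nothing else.
  bif D.all fun d => Nat.beq (weight m d) 0 || (Nat.ble 3 (weight m d) ||
      gens.any fun g => parity m (Nat.land d g)) then
    -- A star `d` leaves at least `need - 1` other stars of weight at least three, within total
    -- weight `2 * m`.
    search m (D.filter fun d => Nat.ble (Nat.add (weight m d) (Nat.mul 3 need))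
      (Nat.add (Nat.mul 2 m) 3)) (Nat.mul 2 m) 0 need (Nat.mul 2 m) 0 0
  else false

theorem sum_mul_eq_zero_of_mem_maskCode {m : ℕ} {gens : List ℕ} {d c : Fin m → ZMod 2}
    (h : ∀ g ∈ gens, ∑ i, dec m g i * d i = 0) (hc : c ∈ maskCode m gens) :
    ∑ i, c i * d i = 0 := by
  have hle : maskCode m gens ≤ LinearMap.ker (Fintype.linearCombination (ZMod 2) d) := by
    refine Submodule.span_le.2 ?_
    rintro _ ⟨g, hg, rfl⟩
    simpa [Fintype.linearCombination_apply] using h g hg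
  simpa [Fintype.linearCombination_apply] using hle hc

/-- The nonzero vertex stars of a graph with this cycle space are a family of the kind searched for.
-/
theorem possiblyGraphic_eq_true {m : ℕ} [NeZero m] {V : Type*} [Fintype V] [DecidableEq V]
    {gens : List ℕ} {p : Fin m → V × V} (hp : maskCode m gens = endsCode p)
    (hK : IsThick (maskCode m gens)) : possiblyGraphic m gens = true := by
  have hends : ∀ i, (p i).1 ≠ (p i).2 := ends_ne fun i => hp ▸ hK.single_notMem i
  have hstar : ∀ v, ∀ g ∈ gens, ∑ i, star p v i * dec m g i = 0 := fun v g hg => by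
    simp only [mul_comm (star p v _)]
    exact mem_endsCode_iff_star.1 (hp ▸ dec_mem_maskCode hg) v
  have hD : ∀ v, enc (star p v) ∈ spanList (perpBasis m gens) := fun v =>
    mem_spanList_perpBasis (enc_lt _) fun g hg => parity_enc (hstar v g hg)
  have hall : ((spanList (perpBasis m gens)).all fun d => Nat.beq (weight m d) 0 ||
      (Nat.ble 3 (weight m d) || gens.any fun g => parity m (Nat.land d g))) = true := by
    rw [List.all_eq_true]
    intro d _
    by_contra hcon
    simp only [Bool.or_eq_true, List.any_eq_true, not_or, not_exists, not_and, Nat.ble_eq,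
      Nat.beq_eq, Bool.not_eq_true] at hcon
    obtain ⟨h0, h3, hg⟩ := hcon
    refine h3 ?_
    rw [weight_eq]
    refine hK.three_le_card (fun hd => h0 ?_) fun c hc => sum_mul_eq_zero_of_mem_maskCode ?_ hc
    · rw [weight_eq, hd]; simp
    · intro g hgm
      simp only [mul_comm (dec m g _)]
      rw [sum_dec_mul_dec, hg g hgm, cond_false]
  have hcard := card_lt_finrank_add_card_star hends
  rw [← hp, Fintype.card_fin] at hcard
  have hrank := finrank_maskCode_le m gens
  have hrank' := Submodule.finrank_le (maskCode m gens)
  rw [Module.finrank_fintype_fun_eq_card, Fintype.card_fin] at hrank'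
  let W := Finset.univ.filter fun v => star p v ≠ 0
  let L := W.toList.map fun v => enc (star p v)
  have hlen : L.length = W.card := by simp [L]
  have hsum : (L.map (weight m)).sum = 2 * m := by
    have := sum_card_star hends
    rw [Fintype.card_fin] at this
    simp only [L, List.map_map]
    rw [← this, ← Finset.sum_map_toList]
    simp only [Function.comp_def, weight_enc]
    rfl
  have hw : ∀ d ∈ L, 3 ≤ weight m d := by
    intro d hd
    obtain ⟨v, hv, rfl⟩ := List.mem_map.1 hd
    rw [weight_enc]
    refine hK.three_le_card (by simpa [W] using hv) fun c hc => ?_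
    exact mem_endsCode_iff_star.1 (hp ▸ hc) v
  have h1 : possiblyGraphic m gens = search m ((spanList (perpBasis m gens)).filter fun d =>
      Nat.ble (Nat.add (weight m d) (Nat.mul 3 (Nat.succ (Nat.sub m gens.length))))
      (Nat.add (Nat.mul 2 m) 3)) (Nat.mul 2 m) 0 (Nat.succ (Nat.sub m gens.length))
      (Nat.mul 2 m) 0 0 := by
    rw [possiblyGraphic, hall, cond_true]
  have hneed : Nat.succ (Nat.sub m gens.length) ≤ L.length := by
    rw [hlen]
    change m - gens.length + 1 ≤ W.card
    have : W.card = (Finset.univ.filter fun v => star p v ≠ 0).card := rfl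
    omega
  rw [h1]
  refine search_eq_true _ _ _ _ _ _ L (fun d hd => ⟨?_, ?_, hw d hd⟩) hsum.le hneed
    (fun j _ h => by rw [bit_zero] at h; cases h) ?_
  · refine List.mem_filter.2 ⟨?_, Nat.ble_eq_true_of_le ?_⟩
    · obtain ⟨v, -, rfl⟩ := List.mem_map.1 hd
      exact hD v
    · have hperm : L.Perm (d :: L.erase d) := List.perm_cons_erase hd
      have h2 : (L.map (weight m)).sum = weight m d + ((L.erase d).map (weight m)).sum := by
        rw [(hperm.map _).sum_eq, List.map_cons, List.sum_cons]
      have h3 : L.length = (L.erase d).length + 1 := by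
        rw [hperm.length_eq, List.length_cons]
      have h4 := List.card_nsmul_le_sum ((L.erase d).map (weight m)) 3 (by
        intro x hx
        obtain ⟨d', hd', rfl⟩ := List.mem_map.1 hx
        exact hw d' (List.mem_of_mem_erase hd'))
      rw [List.length_map, smul_eq_mul] at h4
      change weight m d + 3 * Nat.succ (Nat.sub m gens.length) ≤ 2 * m + 3
      omega
  · obtain ⟨v, -, rfl⟩ := List.mem_map.1 hd
    exact enc_lt _
  · intro j hj
    rw [bit_zero, Bool.toNat_false, add_zero, add_zero]
    -- The number of stars containing edge `j` is the number of its ends, which is two as there are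
    -- no loops.
    have h2 := card_star_ne_zero (hends ⟨j, hj⟩)
    rw [← h2]
    simp only [L, List.countP_map]
    rw [List.countP_eq_length_filter, ← List.toFinset_card_of_nodup (W.nodup_toList.filter _)]
    congr 1
    ext v
    have hb := bit_enc (star p v) ⟨j, hj⟩
    simp only [List.mem_toFinset, List.mem_filter, Finset.mem_toList, Function.comp_apply, hb,
      decide_eq_true_eq, Finset.mem_filter, Finset.mem_univ, true_and, W]
    constructor
    · rintro ⟨-, h⟩
      rw [h]; exact one_ne_zero
    · intro h
      exact ⟨fun h0 => h (congrFun h0 _), (zmod_two_cases _).resolve_left h⟩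

/-- With `r` the dimension of the cycle space, there are at least `|E| - r + 1` vertices of degree
at least three, and the degrees add up to `2|E|`. -/
theorem card_add_three_le {ι V : Type*} [Fintype ι] [Nonempty ι] [DecidableEq ι] [Fintype V]
    [DecidableEq V] {p : ι → V × V} (hK : IsThick (endsCode p)) :
    Fintype.card ι + 3 ≤ 3 * Module.finrank (ZMod 2) (endsCode p) := by
  have hends : ∀ i, (p i).1 ≠ (p i).2 := ends_ne hK.single_notMem
  have h1 := card_lt_finrank_add_card_star hends
  have h2 := sum_card_star hends
  have h3 := Finset.card_nsmul_le_sum (Finset.univ.filter fun v => star p v ≠ 0)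
    (fun v => (Finset.univ.filter fun i => star p v i ≠ 0).card) 3 fun v hv =>
      hK.three_le_card (by simpa using hv) fun c hc => mem_endsCode_iff_star.1 hc v
  rw [smul_eq_mul] at h3
  omega

/-! ### Testing isomorphism -/

/-- The mask whose `i`-th digit is the digit of `n` at the `i`-th position in the list. -/
def permMask (σ : List ℕ) (n : ℕ) : ℕ :=
  σ.foldr (fun s acc => Nat.add (bif bit n s then 1 else 0) (Nat.mul 2 acc)) 0

theorem bit_permMask (σ : List ℕ) (n i : ℕ) (hi : i < σ.length) :
    bit (permMask σ n) i = bit n σ[i] := by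
  induction σ generalizing i with
  | nil => simp at hi
  | cons s σ ih =>
    have h : permMask (s :: σ) n = 2 * permMask σ n + (bit n s).toNat := by
      change (bif bit n s then 1 else 0) + 2 * permMask σ n = _
      rw [add_comm]
      cases bit n s <;> rfl
    rw [h, bit_eq_testBit]
    cases i with
    | zero =>
      rw [List.getElem_cons_zero, Nat.testBit_zero]
      cases bit n s <;> simp
    | succ i =>
      rw [List.getElem_cons_succ, ← ih i (by simpa using hi), Nat.testBit_succ]
      have := Bool.toNat_le (bit n s)
      rw [show (2 * permMask σ n + (bit n s).toNat) / 2 = permMask σ n by omega,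
        bit_eq_testBit]

/-- The list represents a permutation of the first `m` natural numbers. -/
def isPermList (m : ℕ) (σ : List ℕ) : Bool :=
  decide (σ.length = m) && (decide σ.Nodup && σ.all fun s => decide (s < m))

/-- A test for two lists of masks to generate the same code up to the given permutation. -/
def isoCheck (m : ℕ) (gens gens' σ : List ℕ) : Bool :=
  isPermList m σ &&
    (gens'.all (fun g => (spanList gens).any (Nat.beq (permMask σ g))) &&
      gens.all fun g => (spanList (gens'.map (permMask σ))).any (Nat.beq g))

theorem exists_equiv_of_isPermList {m : ℕ} {σ : List ℕ} (h : isPermList m σ = true) :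
    ∃ τ : Fin m ≃ Fin m, (∀ i : Fin m, σ[i.1]? = some (τ i).1) ∧
      ∀ n, dec m (permMask σ n) = dec m n ∘ τ := by
  simp only [isPermList, Bool.and_eq_true, decide_eq_true_eq, List.all_eq_true] at h
  obtain ⟨rfl, hn, hlt⟩ := h
  let f : Fin σ.length → Fin σ.length := fun i => ⟨σ[i], hlt _ (List.getElem_mem _)⟩
  have hf : Function.Injective f := fun i j hij =>
    Fin.ext ((hn.getElem_inj_iff).1 (congrArg Fin.val hij))
  refine ⟨Equiv.ofBijective f (Finite.injective_iff_bijective.1 hf),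
    fun i => List.getElem?_eq_getElem i.2, fun n => ?_⟩
  funext i
  simp only [dec, Function.comp_apply, Equiv.ofBijective_apply, f]
  rw [bit_permMask _ _ _ i.2]
  rfl

/-- The values of `τ` are recorded along with the equality of codes because a later reduction needs
permutations that fix the two splitting elements. -/
theorem exists_equiv_of_isoCheck {m : ℕ} {gens gens' σ : List ℕ}
    (h : isoCheck m gens gens' σ = true) :
    ∃ τ : Fin m ≃ Fin m, (∀ i : Fin m, σ[i.1]? = some (τ i).1) ∧
    maskCode m gens = (maskCode m gens').map (LinearMap.funLeft (ZMod 2) (ZMod 2) τ) := by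
  rw [isoCheck, Bool.and_eq_true, Bool.and_eq_true] at h
  obtain ⟨hσ, h1, h2⟩ := h
  obtain ⟨τ, hτσ, hτ⟩ := exists_equiv_of_isPermList hσ
  have hmap : (maskCode m gens').map (LinearMap.funLeft (ZMod 2) (ZMod 2) τ) =
      maskCode m (gens'.map (permMask σ)) := by
    rw [maskCode, maskCode, Submodule.map_span]
    congr 1
    ext c
    simp only [Set.mem_image, List.mem_map]
    constructor
    · rintro ⟨_, ⟨g, hg, rfl⟩, rfl⟩
      exact ⟨_, ⟨g, hg, rfl⟩, hτ g⟩
    · rintro ⟨_, ⟨g, hg, rfl⟩, rfl⟩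
      exact ⟨_, ⟨g, hg, rfl⟩, (hτ g).symm⟩
  refine ⟨τ, hτσ, ?_⟩
  rw [hmap]
  simp only [List.all_eq_true, List.any_eq_true, Nat.beq_eq] at h1 h2
  apply le_antisymm
  · refine Submodule.span_le.2 ?_
    rintro _ ⟨g, hg, rfl⟩
    obtain ⟨n, hn, rfl⟩ := h2 g hg
    exact mem_maskCode.2 ⟨_, hn, rfl⟩
  · refine Submodule.span_le.2 ?_
    rintro _ ⟨g, hg, rfl⟩
    obtain ⟨k, hk, rfl⟩ := List.mem_map.1 hg
    obtain ⟨n, hn, hkn⟩ := h1 k hk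
    exact mem_maskCode.2 ⟨n, hn, by rw [hkn]⟩

theorem IsIso.symm {α β : Type*} {M : Matroid α} {N : Matroid β} (h : IsIso M N) : IsIso N M := by
  obtain ⟨φ, hφ⟩ := h
  refine ⟨φ.symm, fun I => ?_⟩
  rw [hφ, ← Set.image_comp φ]
  simp

theorem CycleCode.isIso_of_isoCheck {m : ℕ} {α β : Type*} {M : Matroid α} {N : Matroid β}
    {e : Fin m → α} {e' : Fin m → β} {gens gens' σ : List ℕ}
    (hM : CycleCode M e (maskCode m gens)) (hN : CycleCode N e' (maskCode m gens'))
    (h : isoCheck m gens gens' σ = true) : IsIso M N := by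
  obtain ⟨τ, -, hτ⟩ := exists_equiv_of_isoCheck h
  exact hM.isIso (hτ ▸ hN.reindex τ)

theorem CycleCode.exists_of_isoCheck {m : ℕ} {α β : Type*} {M : Matroid α} {N : Matroid β}
    {e' : Fin m → β} {gens gens' σ : List ℕ} (hMN : IsIso M N)
    (hN : CycleCode N e' (maskCode m gens')) (h : isoCheck m gens gens' σ = true) :
    ∃ e, CycleCode M e (maskCode m gens) := by
  obtain ⟨τ, -, hτ⟩ := exists_equiv_of_isoCheck h
  exact (hτ ▸ hN.reindex τ).exists_of_isIso hMN.symm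

/-! ### The cycle codes of the graphs -/

theorem cycleCode_graphOfEnds_maskCode {n m : ℕ} {p : Fin m → Fin n × Fin n} {gens : List ℕ}
    (h1 : ∀ v, ∀ g ∈ gens, ∑ i, dec m g i * star p v i = 0)
    (h2 : perpBasis m ((List.finRange n).map fun v => enc (star p v)) = gens) :
    CycleCode (cycleMatroid (graphOfEnds p)) id (maskCode m gens) :=
  endsCode_eq_maskCode _ h1 h2 ▸ cycleCode_graphOfEnds p

/-- Here and below digit `i` of a mask stands for the `i`-th edge; the masks are fundamental cycles
with respect to a spanning tree. -/
theorem cycleCode_graphG6 :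
    CycleCode (cycleMatroid graphG6) id (maskCode 10 [63, 71, 140, 284, 526]) :=
  cycleCode_graphOfEnds_maskCode (by decide +kernel) (by decide +kernel)

theorem cycleCode_graphG7 :
    CycleCode (cycleMatroid graphG7) id (maskCode 10 [6, 123, 139, 314, 538]) :=
  cycleCode_graphOfEnds_maskCode (by decide +kernel) (by decide +kernel)

theorem cycleCode_graphG8 :
    CycleCode (cycleMatroid graphG8) id (maskCode 10 [12, 119, 135, 310, 534]) :=
  cycleCode_graphOfEnds_maskCode (by decide +kernel) (by decide +kernel)

theorem cycleCode_graphG9 :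
    CycleCode (cycleMatroid graphG9) id (maskCode 11 [63, 193, 327, 607, 1036]) :=
  cycleCode_graphOfEnds_maskCode (by decide +kernel) (by decide +kernel)

theorem cycleCode_graphG10 :
    CycleCode (cycleMatroid graphG10) id (maskCode 8 [15, 49, 83, 151]) :=
  cycleCode_graphOfEnds_maskCode (by decide +kernel) (by decide +kernel)

/-- The masks of four squares generating the cycle space of `K_{3,3}`; the `j`-th one is the only
one that contains the edge `cotreeK33 j`. -/
def gensK33 : List ℕ := [27, 45, 195, 325]

/-- The edges outside a spanning tree of `K_{3,3}`. -/
def cotreeK33 : Fin 4 → Fin 9 := ![4, 5, 7, 8]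

theorem endsCode_endsK33 : endsCode endsK33 = maskCode 9 gensK33 :=
  endsCode_eq_maskCode [Sum.inl 0, Sum.inl 1, Sum.inl 2, Sum.inr 0, Sum.inr 1, Sum.inr 2]
    (by decide +kernel) (by decide +kernel)

/-- Permuting the rows and columns of the three by three square of edges of `K_{3,3}`. -/
def permK33 (r s : Equiv.Perm (Fin 3)) : Equiv.Perm (Fin 9) :=
  (finProdFinEquiv (m := 3) (n := 3)).permCongr (r.prodCongr s)

theorem endsK33_finProdFinEquiv (a b : Fin 3) :
    endsK33 (finProdFinEquiv (m := 3) (n := 3) (a, b)) = (Sum.inl a, Sum.inr b) := by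
  revert a b
  decide

/-- Edges of `K_{3,3}` are the cells of a three by three square and vertex stars are its rows and
columns; this makes the row and column symmetries visible. -/
theorem mem_maskCode_gensK33 {c : Fin 9 → ZMod 2} : c ∈ maskCode 9 gensK33 ↔
    (∀ a, ∑ b, c (finProdFinEquiv (m := 3) (n := 3) (a, b)) = 0) ∧
      ∀ b, ∑ a, c (finProdFinEquiv (m := 3) (n := 3) (a, b)) = 0 := by
  rw [← endsCode_endsK33, mem_endsCode_iff_star, Sum.forall]
  refine and_congr (forall_congr' fun a => ?_) (forall_congr' fun b => ?_)
  · rw [← (finProdFinEquiv (m := 3) (n := 3)).sum_comp, Fintype.sum_prod_type]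
    simp only [star, endsK33_finProdFinEquiv]
    simp
  · rw [← (finProdFinEquiv (m := 3) (n := 3)).sum_comp, Fintype.sum_prod_type]
    simp only [star, endsK33_finProdFinEquiv]
    simp

theorem comp_permK33_mem {c : Fin 9 → ZMod 2} (r s : Equiv.Perm (Fin 3))
    (hc : c ∈ maskCode 9 gensK33) : c ∘ permK33 r s ∈ maskCode 9 gensK33 := by
  rw [mem_maskCode_gensK33] at hc ⊢
  simp only [permK33, Function.comp_apply, Equiv.permCongr_apply, Equiv.symm_apply_apply,
    Equiv.prodCongr_apply, Prod.map_apply]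
  exact ⟨fun a => (Equiv.sum_comp s _).trans (hc.1 (r a)),
    fun b => (Equiv.sum_comp r fun a => c (finProdFinEquiv (a, s b))).trans (hc.2 (s b))⟩

theorem map_permK33 (r s : Equiv.Perm (Fin 3)) :
    (maskCode 9 gensK33).map (LinearMap.funLeft (ZMod 2) (ZMod 2) (permK33 r s)) =
      maskCode 9 gensK33 := by
  ext c
  constructor
  · rintro ⟨d, hd, rfl⟩
    exact comp_permK33_mem r s hd
  · intro hc
    refine ⟨c ∘ (permK33 r s).symm, comp_permK33_mem r.symm s.symm hc, ?_⟩
    funext i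
    simp [LinearMap.funLeft_apply]

/-- A matroid isomorphic to the cycle matroid of `K_{3,3}` has a labelling that starts with a given
element. -/
theorem exists_cycleCode_gensK33 {β : Type*} {N : Matroid β}
    (h : IsIso N (cycleMatroid graphK33)) {b : β} (hb : b ∈ N.E) :
    ∃ e, CycleCode N e (maskCode 9 gensK33) ∧ e 0 = b := by
  obtain ⟨e, he⟩ := (endsCode_endsK33 ▸ cycleCode_graphK33).exists_of_isIso h.symm
  obtain ⟨i, rfl⟩ := he.range_eq.symm ▸ hb
  -- These automorphisms act transitively on the edges.
  have hrs : ∀ i : Fin 9, ∃ r s, permK33 r s 0 = i := by decide +kernel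
  obtain ⟨r, s, rfl⟩ := hrs i
  exact ⟨e ∘ permK33 r s, map_permK33 r s ▸ he.reindex (permK33 r s), rfl⟩

theorem single_notMem_gensK33 (i : Fin 9) : Pi.single i 1 ∉ maskCode 9 gensK33 := by
  rw [mem_maskCode]
  revert i
  decide +kernel

theorem exists_mem_gensK33 (i : Fin 9) : ∃ c ∈ maskCode 9 gensK33, c i = 1 := by
  have : ∃ g ∈ gensK33, dec 9 g i = 1 := by
    revert i
    decide +kernel
  obtain ⟨g, hg, h1⟩ := this
  exact ⟨_, dec_mem_maskCode hg, h1⟩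

/-- The four squares form the dual basis to the coordinates at the cotree edges. -/
theorem eq_sum_gensK33 {c : Fin 9 → ZMod 2} (hc : c ∈ maskCode 9 gensK33) :
    c = ∑ j, c (cotreeK33 j) • dec 9 (gensK33.get j) := by
  obtain ⟨n, hn, rfl⟩ := mem_maskCode.1 hc
  clear hc
  revert n
  decide +kernel

/-! ### Minors of the element splitting matroid -/

theorem CycleCode.isThick {ι α : Type*} [Finite ι] [DecidableEq ι] {M : Matroid α} {e : ι → α}
    {K : Submodule (ZMod 2) (ι → ZMod 2)} (h : CycleCode M e K)
    (hs : ∀ u v : α, u ≠ v → ¬ M.IsCocircuit {u, v}) (h1 : ∀ i, Pi.single i 1 ∉ K)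
    (h2 : ∀ i, ∃ c ∈ K, c i ≠ 0) : IsThick K := by
  refine ⟨h1, h2, fun i k hik => ?_⟩
  by_contra! hcon
  exact hs _ _ (h.inj.ne hik) (h.isCocircuit_pair hik (h2 i) (h2 k) hcon)

theorem IsElementSplitting.exists_cycleCode {ι α : Type*} [Fintype ι] {M : Matroid α} {X : Set α}
    {M' : Matroid (Option α)} (hM' : IsElementSplitting M X M') {e : ι → α}
    (he : Function.Injective e) (hE : Set.range e = M.E) : ∃ K, CycleCode M e K := by
  obtain ⟨m, A, hA, -⟩ := hM'
  refine ⟨relations (A.col ∘ e), ?_⟩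
  have : CycleCode (matrixMatroid M.E A) e (relations (A.col ∘ e)) :=
    cycleCode_vectorMatroid _ he hE
  rwa [← hA] at this

theorem IsElementSplitting.ground_eq {α : Type*} {M : Matroid α} {X : Set α}
    {M' : Matroid (Option α)} (hM' : IsElementSplitting M X M') :
    M'.E = insert none (some '' M.E) := by
  obtain ⟨m, A, -, rfl⟩ := hM'
  rfl

/-- The cycles that contain both or neither of the elements labelled `i` and `k`. -/
def pairCode {ι : Type*} (K : Submodule (ZMod 2) (ι → ZMod 2)) (i k : ι) :
    Submodule (ZMod 2) (ι → ZMod 2) :=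
  K ⊓ LinearMap.eqLocus (LinearMap.proj i) (LinearMap.proj k)

theorem mem_pairCode {ι : Type*} {K : Submodule (ZMod 2) (ι → ZMod 2)} {i k : ι}
    {c : ι → ZMod 2} : c ∈ pairCode K i k ↔ c ∈ K ∧ c i = c k := Iff.rfl

section

variable {ι κ α : Type*} [Fintype ι] {M : Matroid α} {e : ι → α}
  {K : Submodule (ZMod 2) (ι → ZMod 2)} {i k : ι} {M' : Matroid (Option α)}

/-- A cycle of `M'` avoids `a` exactly when `c i + c k = 0`. -/
theorem IsElementSplitting.cycleCode_delete (hM' : IsElementSplitting M {e i, e k} M')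
    (h : CycleCode M e K) (hik : i ≠ k) :
    CycleCode (M' ＼ {none}) (some ∘ e) (pairCode K i k) := by
  have hset : Option.map e '' (Set.range some)ᶜ = {none} := by
    have : (Set.range (some : ι → Option ι))ᶜ = {none} := by
      ext o; cases o <;> simp
    rw [this, Set.image_singleton]
    rfl
  have := (hM'.cycleCode h hik).delete some (Option.some_injective ι) (L := pairCode K i k) ?_
  · rwa [hset] at this
  · intro d
    simp only [mem_pairCode, mem_splitCode]
    constructor
    · rintro ⟨hd, hdik⟩
      refine ⟨fun o => o.elim 0 d, ⟨hd, ?_⟩, ?_, rfl⟩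
      · simp only [Option.elim]
        rw [hdik, zmod_two_add_self]
      · rintro (_ | l) hl
        · rfl
        · exact absurd ⟨l, rfl⟩ hl
    · rintro ⟨c, ⟨hc, hcn⟩, h0, rfl⟩
      refine ⟨hc, ?_⟩
      rw [h0 none (by simp)] at hcn
      rw [Function.comp_apply, Function.comp_apply, ← sub_eq_zero, CharTwo.sub_eq_add]
      exact hcn.symm

theorem IsElementSplitting.cycleCode_delete_contract
    (hM' : IsElementSplitting M {e i, e k} M') (h : CycleCode M e K) (hik : i ≠ k) (j : κ → ι)
    (hj : Function.Injective j) (hind : ∀ c ∈ pairCode K i k, c ∘ j = 0 → c = 0)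
    {X : Set (Option α)} (hX : (some ∘ e) '' (Set.range j)ᶜ = X) :
    CycleCode (M' ＼ {none} ／ X) (some ∘ e ∘ j)
      ((pairCode K i k).map (LinearMap.funLeft (ZMod 2) (ZMod 2) j)) := by
  have h' := hM'.cycleCode_delete h hik
  rw [← hX]
  refine h'.contract j hj ((h'.indep_iff _).2 fun c hc hz => hind c hc ?_)
  funext l
  exact hz _ fun hl => hl ⟨l, rfl⟩

theorem IsElementSplitting.cycleCode_contract
    (hM' : IsElementSplitting M {e i, e k} M') (h : CycleCode M e K) (hik : i ≠ k)
    (j : κ → Option ι) (hj : Function.Injective j)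
    (hind : ∀ c ∈ splitCode K i k, c ∘ j = 0 → c = 0)
    {X : Set (Option α)} (hX : Option.map e '' (Set.range j)ᶜ = X) :
    CycleCode (M' ／ X) (Option.map e ∘ j)
      ((splitCode K i k).map (LinearMap.funLeft (ZMod 2) (ZMod 2) j)) := by
  have h' := hM'.cycleCode h hik
  rw [← hX]
  refine h'.contract j hj ((h'.indep_iff _).2 fun c hc hz => hind c hc ?_)
  funext l
  exact hz _ fun hl => hl ⟨l, rfl⟩

end

/-- Completing generators of a hyperplane to generators of a code. -/
theorem exists_maskCode_eq {m : ℕ} {K : Submodule (ZMod 2) (Fin m → ZMod 2)} {p q : Fin m}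
    {t : Fin 4 → Fin m} {G : Fin 4 → ℕ} (hK : pairCode K p q = maskCode m (List.ofFn G))
    (hdual : ∀ j l, dec m (G l) (t j) = if l = j then 1 else 0) (hne : ∃ w ∈ K, w p ≠ w q) :
    ∃ n < 2 ^ m, (∀ j, bit n (t j) = false) ∧ bit n p ≠ bit n q ∧
      K = maskCode m (n :: List.ofFn G) := by
  have hGm : ∀ j, dec m (G j) ∈ maskCode m (List.ofFn G) := fun j =>
    dec_mem_maskCode (List.mem_ofFn.2 ⟨j, rfl⟩)
  have hG : ∀ j, dec m (G j) ∈ K := fun j => (mem_pairCode.1 (hK.symm ▸ hGm j)).1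
  have hpq : ∀ j, dec m (G j) p = dec m (G j) q := fun j =>
    (mem_pairCode.1 (hK.symm ▸ hGm j)).2
  -- By duality with `t`, the coordinates at `t` are the coefficients in the basis `G`.
  have hgen : ∀ c ∈ maskCode m (List.ofFn G), c = ∑ j, c (t j) • dec m (G j) := by
    intro c hc
    refine Submodule.span_induction ?_ ?_ ?_ ?_ hc
    · rintro _ ⟨g, hg, rfl⟩
      obtain ⟨l, rfl⟩ := List.mem_ofFn.1 hg
      simp [hdual]
    · simp
    · intro a b _ _ ha hb
      simp only [Pi.add_apply, add_smul, Finset.sum_add_distrib]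
      rw [← ha, ← hb]
    · intro a b _ hb
      simp only [Pi.smul_apply, smul_assoc, ← Finset.smul_sum]
      rw [← hb]
  obtain ⟨w, hw, hwpq⟩ := hne
  -- Subtracting an element of the hyperplane makes the extra generator vanish on `t` and keeps it
  -- outside the hyperplane.
  let w' := w + ∑ j, w (t j) • dec m (G j)
  have hw' : w' ∈ K := K.add_mem hw (K.sum_mem fun j _ => K.smul_mem _ (hG j))
  have hw'pq : w' p ≠ w' q := by
    intro h
    refine hwpq ?_
    simpa [w', hpq] using h
  have hw't : ∀ j, w' (t j) = 0 := by
    intro j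
    simp [w', hdual, zmod_two_add_self]
  have hwq : w' p + w' q = 1 := by
    rcases zmod_two_cases (w' p) with h | h <;> rcases zmod_two_cases (w' q) with h' | h' <;>
      rw [h, h'] at hw'pq ⊢ <;> first | rfl | exact absurd rfl hw'pq
  refine ⟨enc w', enc_lt w', fun j => ?_, ?_, le_antisymm ?_ ?_⟩
  · rw [bit_enc, hw't]; rfl
  · rw [bit_enc, bit_enc]
    rcases zmod_two_cases (w' p) with h | h <;> rcases zmod_two_cases (w' q) with h' | h' <;>
      rw [h, h'] at hw'pq ⊢ <;> first | exact absurd rfl hw'pq | decide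
  · intro c hc
    -- Adding `w'` when `c p ≠ c q` moves `c` into the hyperplane.
    let c' := c + (c p + c q) • w'
    have hc' : c' ∈ K := K.add_mem hc (K.smul_mem _ hw')
    have hc'pq : c' p = c' q := by
      rw [← sub_eq_zero, CharTwo.sub_eq_add]
      have : c' p + c' q = (c p + c q) + (c p + c q) * (w' p + w' q) := by
        simp only [c', Pi.add_apply, Pi.smul_apply, smul_eq_mul]; ring
      rw [this, hwq, mul_one, zmod_two_add_self]
    have hmem : ∀ j, dec m (G j) ∈ maskCode m (enc w' :: List.ofFn G) := fun j =>
      dec_mem_maskCode (List.mem_cons_of_mem _ (List.mem_ofFn.2 ⟨j, rfl⟩))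
    have hwm : w' ∈ maskCode m (enc w' :: List.ofFn G) := by
      have := dec_mem_maskCode (m := m) (g := enc w') (gens := enc w' :: List.ofFn G)
        List.mem_cons_self
      rwa [dec_enc] at this
    have hcm : c' ∈ maskCode m (enc w' :: List.ofFn G) := by
      rw [hgen c' (hK ▸ mem_pairCode.2 ⟨hc', hc'pq⟩)]
      exact Submodule.sum_mem _ fun j _ => Submodule.smul_mem _ _ (hmem j)
    have := Submodule.add_mem _ hcm (Submodule.smul_mem _ (c p + c q) hwm)
    rwa [show c' + (c p + c q) • w' = c by
      simp only [c']; rw [add_assoc, zmod_two_add_self, add_zero]] at this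
  · refine Submodule.span_le.2 ?_
    rintro _ ⟨g, hg, rfl⟩
    rcases List.mem_cons.1 hg with rfl | hg
    · rw [dec_enc]; exact hw'
    · obtain ⟨j, rfl⟩ := List.mem_ofFn.1 hg
      exact hG j

/-- The conditions on the two elements at which a matroid is split. -/
structure IsSplittingPair {α : Type*} (M : Matroid α) (x y : α) : Prop where
  left_mem : x ∈ M.E
  right_mem : y ∈ M.E
  ne : x ≠ y
  left_not_isLoop : ¬ M.IsLoop x
  right_not_isLoop : ¬ M.IsLoop y
  left_not_isColoop : ¬ M.IsColoop x
  right_not_isColoop : ¬ M.IsColoop y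
  not_isCircuit : ¬ M.IsCircuit {x, y}

theorem IsSplittingPair.insert_insert_sdiff {α : Type*} {M : Matroid α} {x y : α}
    (h : IsSplittingPair M x y) : insert x (insert y (M.E \ {x, y})) = M.E := by
  conv_rhs => rw [← Set.union_sdiff_cancel (Set.pair_subset h.left_mem h.right_mem),
    Set.insert_union, Set.singleton_union]

theorem exists_ne_zero_of_not_isColoop {ι α : Type*} [Finite ι] {M : Matroid α} {e : ι → α}
    {K : Submodule (ZMod 2) (ι → ZMod 2)} (h : CycleCode M e K) {i : ι}
    (hi : ¬ M.IsColoop (e i)) : ∃ c ∈ K, c i ≠ 0 := by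
  rw [h.isColoop_iff] at hi
  push Not at hi
  exact hi

theorem exists_eq_some_comp {κ α : Type*} {g : κ → Option α} (h : ∀ i, g i ≠ none) :
    ∃ f : κ → α, g = some ∘ f := by
  choose f hf using fun i => Option.ne_none_iff_exists'.1 (h i)
  exact ⟨f, funext hf⟩

theorem range_eq_of_some_comp {κ α : Type*} {f : κ → α} {E : Set α}
    (h : Set.range (some ∘ f) = some '' E) : Set.range f = E := by
  rw [Set.range_comp] at h
  exact Set.image_injective.2 (Option.some_injective α) h

/-! ### The five kinds of minors -/

section

variable {α : Type*} {M : Matroid α} {x y : α} {M' : Matroid (Option α)}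

/-- A labelling of a matroid on `Option α` that starts with the new element. -/
theorem exists_labelling_of_none {N : Matroid (Option α)} {E : Set α}
    (hN : IsIso N (cycleMatroid graphK33)) (hE : N.E = insert none (some '' E)) :
    ∃ (g : Fin 9 → Option α) (f : Fin 8 → α), CycleCode N g (maskCode 9 gensK33) ∧
      Function.Injective f ∧ Set.range f = E ∧ g 0 = none ∧ ∀ i : Fin 8, g i.succ = some (f i) := by
  obtain ⟨g, hg, hg0⟩ := exists_cycleCode_gensK33 hN (b := none) (by simp [hE])
  have hne : ∀ i : Fin 8, g i.succ ≠ none := fun i h =>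
    Fin.succ_ne_zero i (hg.inj (h.trans hg0.symm))
  obtain ⟨f, hf⟩ := exists_eq_some_comp hne
  have hf' : ∀ i : Fin 8, g i.succ = some (f i) := congrFun hf
  refine ⟨g, f, hg, fun i k hik => ?_, ?_, hg0, hf'⟩
  · exact Fin.succ_injective _ (hg.inj (by rw [hf', hf', hik]))
  · ext z
    have hz : z ∈ E ↔ some z ∈ Set.range g := by rw [hg.range_eq, hE]; simp
    rw [hz]
    constructor
    · rintro ⟨i, rfl⟩
      exact ⟨i.succ, hf' i⟩
    · rintro ⟨l, hl⟩
      revert hl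
      refine Fin.cases (fun h => ?_) (fun i h => ⟨i, ?_⟩) l
      · exact absurd (hg0.symm.trans h) (Option.some_ne_none z).symm
      · exact Option.some_injective _ ((hf' i).symm.trans h)

/-- The coordinate at `a` is determined by those at `x` and `y`, so the cycles of `M` are those of
`M'` with `a` forgotten. By edge transitivity `a` is edge 0, and contracting an edge of `K_{3,3}`
gives the wheel with four spokes. -/
theorem isIso_graphG10_of_splitting (hM' : IsElementSplitting M {x, y} M')
    (hp : IsSplittingPair M x y) (hiso : IsIso M' (cycleMatroid graphK33)) :
    IsIso M (cycleMatroid graphG10) := by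
  obtain ⟨g, f, hg, hf, hfE, hg0, hgs⟩ := exists_labelling_of_none hiso hM'.ground_eq
  obtain ⟨K, hK⟩ := hM'.exists_cycleCode hf hfE
  obtain ⟨i, rfl⟩ := hfE.symm ▸ hp.left_mem
  obtain ⟨k, rfl⟩ := hfE.symm ▸ hp.right_mem
  have hik : i ≠ k := fun h => hp.ne (h ▸ rfl)
  have h1 := (hM'.cycleCode hK hik).reindex (finSuccEquiv 8)
  have hgf : Option.map f ∘ finSuccEquiv 8 = g := by
    funext l
    refine Fin.cases ?_ (fun l => ?_) l
    · rw [hg0]; rfl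
    · rw [hgs]; rfl
  rw [hgf] at h1
  have hrel := hg.unique h1
  -- The masks in `gensK33` halved, which drops digit 0, the coordinate of `a`.
  have hKm : K = maskCode 8 [13, 22, 97, 162] := by
    apply le_antisymm
    · intro c hc
      let c' : Option (Fin 8) → ZMod 2 := fun o => o.elim (c i + c k) c
      have hc' : c' ∘ finSuccEquiv 8 ∈ maskCode 9 gensK33 := by
        rw [hrel]
        exact ⟨c', ⟨hc, rfl⟩, rfl⟩
      obtain ⟨n, hn, hnc⟩ := mem_maskCode.1 hc'
      have hcn : c = dec 8 (n / 2) := by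
        funext l
        have := congrFun hnc l.succ
        simp only [Function.comp_apply, finSuccEquiv_succ, c', Option.elim] at this
        rw [← this, dec, dec, bit_eq_testBit, bit_eq_testBit, Fin.val_succ, Nat.testBit_succ]
      rw [hcn, mem_maskCode]
      have key : ∀ n ∈ spanList gensK33, ∃ k ∈ spanList [13, 22, 97, 162],
          dec 8 k = dec 8 (n / 2) := by decide +kernel
      exact key n hn
    · refine Submodule.span_le.2 ?_
      rintro _ ⟨n, hn, rfl⟩
      have key : ∀ n ∈ [13, 22, 97, 162], ∃ g ∈ gensK33, ∀ l : Fin 8,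
          dec 9 g l.succ = dec 8 n l := by decide +kernel
      obtain ⟨b, hb, hbn⟩ := key n hn
      obtain ⟨c, ⟨hc, -⟩, hcb⟩ := hrel ▸ dec_mem_maskCode (m := 9) hb
      have hcn : dec 8 n = c ∘ some := by
        funext l
        rw [← hbn, ← hcb]
        rfl
      change dec 8 n ∈ K
      rw [hcn]
      exact hc
  rw [hKm] at hK
  exact hK.isIso_of_isoCheck cycleCode_graphG10 (σ := [4, 6, 5, 0, 1, 7, 3, 2]) (by decide +kernel)

/-- In `M' / x` the coordinate at `a` is `c(x) + c(y)`, so `c(x)` is recovered by adding the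
coordinates at `a` and `y`. Hence `K` depends only on which of the eight remaining edges of
`K_{3,3}` is `y`, and each of the eight codes fails the star search. -/
theorem not_isIso_contract_of_splitting (hG : IsGraphic M)
    (hs : ∀ u v : α, u ≠ v → ¬ M.IsCocircuit {u, v}) (hM' : IsElementSplitting M {x, y} M')
    (hp : IsSplittingPair M x y) : ¬ IsIso (M' ／ {some x}) (cycleMatroid graphK33) := by
  intro hiso
  obtain ⟨g, f, hg, hf, hfE, hg0, hgs⟩ := exists_labelling_of_none (E := M.E \ {x}) hiso (by
    rw [Matroid.contract_ground, hM'.ground_eq]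
    ext o; cases o <;> simp)
  obtain ⟨k, hk⟩ : y ∈ Set.range f := hfE ▸ ⟨hp.right_mem, hp.ne.symm⟩
  have hfx : ∀ i, f i ≠ x := fun i h => (hfE.subset (Set.mem_range_self i)).2 h
  let e : Fin 9 → α := Fin.cons x f
  have he : Function.Injective e := Fin.cons_injective_iff.2 ⟨fun ⟨i, hi⟩ => hfx i hi, hf⟩
  have heE : Set.range e = M.E := by
    rw [Fin.range_cons, hfE, Set.insert_sdiff_singleton, Set.insert_eq_of_mem hp.left_mem]
  obtain ⟨K, hK⟩ := hM'.exists_cycleCode he heE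
  have he0 : e 0 = x := rfl
  have hek : e k.succ = y := hk
  have hM'e : IsElementSplitting M {e 0, e k.succ} M' := by rwa [he0, hek]
  let j : Fin 9 → Option (Fin 9) := Fin.cons none fun i => some i.succ
  have hj : Function.Injective j := by decide
  have hjr : (Set.range j)ᶜ = {some 0} := by
    ext o
    simp only [Set.mem_compl_iff, Set.mem_singleton_iff]
    rw [Set.mem_range]
    revert o
    decide
  have hj0 : j 0 = none := rfl
  have h1 := hM'e.cycleCode_contract hK (Fin.succ_ne_zero k).symm j hj (X := {some x}) (by
    rintro c ⟨hc, hcn⟩ hz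
    have hn : c none = 0 := congrFun hz 0
    have hzs : ∀ i : Fin 8, c (some i.succ) = 0 := fun i => congrFun hz i.succ
    rw [hn, hzs k, add_zero] at hcn
    funext o
    rcases o with _ | o
    · exact hn
    · exact Fin.cases hcn.symm hzs o) (by rw [hjr, Set.image_singleton]; rfl)
  have hgj : Option.map e ∘ j = g := by
    funext l
    refine Fin.cases ?_ (fun l => ?_) l
    · rw [hg0]; rfl
    · rw [hgs]; rfl
  rw [hgj] at h1
  have hrel := hg.unique h1
  -- the cycles of `M` are obtained from those of the contraction by adding `y` to `a`
  have hmem : ∀ c, c ∈ K ↔ c + Pi.single 0 (c k.succ) ∈ maskCode 9 gensK33 := by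
    intro c
    have hs0 : ∀ (d : Fin 9 → ZMod 2) (a : ZMod 2) (i : Fin 8),
        (d + (Pi.single 0 a : Fin 9 → ZMod 2)) i.succ = d i.succ := by
      intro d a i
      simp
    rw [hrel]
    constructor
    · intro hc
      refine ⟨fun o => o.elim (c 0 + c k.succ) c, ⟨hc, rfl⟩, ?_⟩
      funext l
      refine Fin.cases ?_ (fun l => ?_) l
      · simp [LinearMap.funLeft_apply, hj0]
      · rw [hs0]; rfl
    · rintro ⟨d, ⟨hd, hdn⟩, hdc⟩
      have h0 := congrFun hdc 0
      have hsucc : ∀ i : Fin 8, d (some i.succ) = c i.succ := fun i => by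
        have := congrFun hdc i.succ
        rwa [hs0] at this
      rw [LinearMap.funLeft_apply, hj0, hdn, hsucc] at h0
      suffices hcd : c = d ∘ some by rw [hcd]; exact hd
      funext l
      refine Fin.cases ?_ (fun l => (hsucc l).symm) l
      simp only [Pi.add_apply, Pi.single_eq_same, add_left_inj] at h0
      exact h0.symm
  have hKm : K = maskCode 9 (gensK33.map fun b => bif bit b k.succ then Nat.xor b 1 else b) := by
    have hdec : ∀ b, dec 9 (bif bit b k.succ then Nat.xor b 1 else b) =
        dec 9 b + Pi.single 0 (dec 9 b k.succ) := by
      intro b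
      have h1 : dec 9 1 = Pi.single 0 1 := by decide
      rw [dec.eq_def 9 b k.succ]
      cases bit b k.succ
      · simp
      · simp only [cond_true]
        rw [dec_xor, h1]
    -- Adding coordinate `y` to coordinate 0 leaves coordinate `y` alone, so it is an involution.
    have hinv : ∀ c : Fin 9 → ZMod 2, c + Pi.single 0 (c k.succ) +
        Pi.single 0 ((c + (Pi.single 0 (c k.succ) : Fin 9 → ZMod 2)) k.succ) = c := by
      intro c
      have h1 : (c + (Pi.single 0 (c k.succ) : Fin 9 → ZMod 2)) k.succ = c k.succ := by simp
      rw [h1, add_assoc, zmod_two_add_self, add_zero]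
    apply le_antisymm
    · intro c hc
      have h2 := eq_sum_gensK33 ((hmem c).1 hc)
      have h3 := hinv c
      rw [h2] at h3
      rw [← h3]
      have h4 : ∀ j, dec 9 (gensK33.get j) + Pi.single 0 (dec 9 (gensK33.get j) k.succ) ∈
          maskCode 9 (gensK33.map fun b => bif bit b k.succ then Nat.xor b 1 else b) := by
        intro j
        rw [← hdec]
        exact dec_mem_maskCode (List.mem_map_of_mem (List.get_mem _ _))
      have h5 : ∀ a : Fin 4 → ZMod 2, ∑ j, a j • dec 9 (gensK33.get j) +
          Pi.single 0 ((∑ j, a j • dec 9 (gensK33.get j)) k.succ) =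
          ∑ j, a j • (dec 9 (gensK33.get j) + Pi.single 0 (dec 9 (gensK33.get j) k.succ)) := by
        intro a
        funext l
        simp only [Pi.add_apply, Finset.sum_apply, Pi.smul_apply, smul_eq_mul, mul_add,
          Finset.sum_add_distrib, add_right_inj]
        by_cases hl : l = 0
        · subst hl; simp
        · simp [hl]
      rw [h5]
      exact Submodule.sum_mem _ fun j _ => Submodule.smul_mem _ _ (h4 j)
    · refine Submodule.span_le.2 ?_
      rintro _ ⟨g, hg, rfl⟩
      obtain ⟨b, hb, rfl⟩ := List.mem_map.1 hg
      change _ ∈ K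
      rw [hmem, hdec, hinv]
      exact dec_mem_maskCode hb
  have hthick : IsThick K := by
    refine hK.isThick hs (fun i => ?_) fun i => ?_
    · rw [← hK.isLoop_iff]
      refine Fin.cases ?_ (fun i => ?_) i
      · exact hp.left_not_isLoop
      · by_cases hik : i = k
        · rw [hik, hek]; exact hp.right_not_isLoop
        · rw [hK.isLoop_iff, hmem]
          have : (Pi.single i.succ 1 : Fin 9 → ZMod 2) k.succ = 0 :=
            Pi.single_eq_of_ne (fun h => hik (Fin.succ_injective _ h).symm) _
          rw [this, Pi.single_zero, add_zero]
          exact single_notMem_gensK33 _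
    · refine Fin.cases ?_ (fun i => ?_) i
      · exact exists_ne_zero_of_not_isColoop hK hp.left_not_isColoop
      · obtain ⟨c, hc, hci⟩ := exists_mem_gensK33 i.succ
        refine ⟨c + Pi.single 0 (c k.succ), ?_, ?_⟩
        · rw [hmem]
          have h1 : (c + (Pi.single 0 (c k.succ) : Fin 9 → ZMod 2)) k.succ = c k.succ := by simp
          rwa [h1, add_assoc, zmod_two_add_self, add_zero]
        · simp [hci]
  obtain ⟨n, p, hKp⟩ := hK.exists_ends hG
  rw [hKm] at hthick hKp
  have hfalse := possiblyGraphic_eq_true hKp hthick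
  have hcheck : ∀ k : Fin 8, possiblyGraphic 9
      (gensK33.map fun b => bif bit b k.succ then Nat.xor b 1 else b) = false := by decide +kernel
  rw [hcheck k] at hfalse
  exact Bool.false_ne_true hfalse

/-- Sending `c` to `c(x) + c(y)` at `a` and to its other coordinates embeds `K` into the cycle space
of `K_{3,3}`, because `x` and `y` are not parallel. So `dim K ≤ 4`, too small for a graph with ten
edges and no loops, coloops or series pairs. -/
theorem not_isIso_contract_pair_of_splitting (hG : IsGraphic M)
    (hs : ∀ u v : α, u ≠ v → ¬ M.IsCocircuit {u, v}) (hM' : IsElementSplitting M {x, y} M')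
    (hp : IsSplittingPair M x y) : ¬ IsIso (M' ／ {some x, some y}) (cycleMatroid graphK33) := by
  intro hiso
  obtain ⟨g, f, hg, hf, hfE, hg0, hgs⟩ := exists_labelling_of_none (E := M.E \ {x, y}) hiso (by
    rw [Matroid.contract_ground, hM'.ground_eq]
    ext o; cases o <;> simp)
  have hfx : ∀ i, f i ≠ x := fun i h => (hfE.subset (Set.mem_range_self i)).2 (Or.inl h)
  have hfy : ∀ i, f i ≠ y := fun i h => (hfE.subset (Set.mem_range_self i)).2 (Or.inr h)
  let e : Fin 10 → α := Fin.cons x (Fin.cons y f)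
  have hyf : y ∉ Set.range f := fun ⟨i, hi⟩ => hfy i hi
  have hxf : x ∉ Set.range (Fin.cons y f : Fin 9 → α) := by
    rw [Fin.range_cons]
    rintro (h | ⟨i, hi⟩)
    · exact hp.ne h
    · exact hfx i hi
  have he : Function.Injective e :=
    Fin.cons_injective_iff.2 ⟨hxf, Fin.cons_injective_iff.2 ⟨hyf, hf⟩⟩
  have heE : Set.range e = M.E := by
    rw [Fin.range_cons, Fin.range_cons, hfE, hp.insert_insert_sdiff]
  obtain ⟨K, hK⟩ := hM'.exists_cycleCode he heE
  have hM'e : IsElementSplitting M {e 0, e 1} M' := hM'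
  have hpair : Pi.single 0 1 + Pi.single 1 1 ∉ K := by
    rw [← hK.isCircuit_pair_iff (i := 0) (k := 1) (by decide) hp.left_not_isLoop
      hp.right_not_isLoop]
    exact hp.not_isCircuit
  let j : Fin 9 → Option (Fin 10) := Fin.cons none fun i => some i.succ.succ
  have hj : Function.Injective j := by decide
  have hjr : (Set.range j)ᶜ = {some 0, some 1} := by
    ext o
    simp only [Set.mem_compl_iff, Set.mem_singleton_iff, Set.mem_insert_iff]
    rw [Set.mem_range]
    revert o
    decide
  have hind : ∀ c ∈ K, c 0 = c 1 → (∀ i : Fin 8, c i.succ.succ = 0) → c = 0 := by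
    intro c hc h01 hz
    rcases zmod_two_cases (c 0) with h | h
    · funext l
      exact Fin.cases h (fun l => Fin.cases (h01 ▸ h) hz l) l
    · refine (hpair ?_).elim
      suffices hcd : Pi.single 0 1 + Pi.single 1 1 = c by rw [hcd]; exact hc
      funext l
      refine Fin.cases ?_ (fun l => Fin.cases ?_ (fun l => ?_) l) l
      · rw [h]; rfl
      · rw [Fin.succ_zero_eq_one, ← h01, h]; rfl
      · rw [hz, Pi.add_apply, Pi.single_eq_of_ne (Fin.succ_ne_zero _), Pi.single_eq_of_ne, add_zero]
        rw [← Fin.succ_zero_eq_one]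
        exact fun h => Fin.succ_ne_zero _ (Fin.succ_injective _ h)
  have h1 := hM'e.cycleCode_contract hK (by decide) j hj (X := {some x, some y}) (by
    rintro c ⟨hc, hcn⟩ hz
    have hn : c none = 0 := congrFun hz 0
    have hzs : ∀ i : Fin 8, c (some i.succ.succ) = 0 := fun i => congrFun hz i.succ
    rw [hn] at hcn
    have h0 := hind _ hc (by
      rw [← sub_eq_zero, CharTwo.sub_eq_add]; exact hcn.symm) hzs
    funext o
    rcases o with _ | o
    · exact hn
    · exact congrFun h0 o) (by rw [hjr, Set.image_pair]; rfl)
  have hgj : Option.map e ∘ j = g := by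
    funext l
    refine Fin.cases ?_ (fun l => ?_) l
    · rw [hg0]; rfl
    · rw [hgs]; rfl
  rw [hgj] at h1
  have hrel := hg.unique h1
  let P : Fin 10 → (Fin 10 → ZMod 2) →ₗ[ZMod 2] ZMod 2 := LinearMap.proj
  let T : (Fin 10 → ZMod 2) →ₗ[ZMod 2] (Fin 9 → ZMod 2) :=
    LinearMap.pi (Fin.cons (α := fun _ => (Fin 10 → ZMod 2) →ₗ[ZMod 2] ZMod 2)
      (P 0 + P 1) fun i => P i.succ.succ)
  have hT0 : ∀ c, T c 0 = c 0 + c 1 := fun c => rfl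
  have hTs : ∀ c (i : Fin 8), T c i.succ = c i.succ.succ := fun c i => rfl
  have hTK : ∀ c ∈ K, T c ∈ maskCode 9 gensK33 := by
    intro c hc
    rw [hrel]
    refine ⟨fun o => o.elim (c 0 + c 1) c, ⟨hc, rfl⟩, ?_⟩
    funext l
    exact Fin.cases rfl (fun l => rfl) l
  have hTinj : Function.Injective (T.restrict hTK) := by
    rw [← LinearMap.ker_eq_bot, LinearMap.ker_eq_bot']
    rintro ⟨c, hc⟩ h0
    have h0' : T c = 0 := congrArg Subtype.val h0
    refine Subtype.ext (hind c hc ?_ fun i => ?_)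
    · have := congrFun h0' 0
      rw [hT0] at this
      rw [← sub_eq_zero, CharTwo.sub_eq_add]; exact this
    · exact congrFun h0' i.succ
  have hrank : Module.finrank (ZMod 2) K ≤ 4 :=
    (LinearMap.finrank_le_finrank_of_injective hTinj).trans (finrank_maskCode_le 9 gensK33)
  have hthick : IsThick K := by
    refine hK.isThick hs (fun i => ?_) fun i => ?_
    · rw [← hK.isLoop_iff]
      refine Fin.cases hp.left_not_isLoop (fun i => Fin.cases hp.right_not_isLoop (fun i => ?_) i) i
      rw [hK.isLoop_iff]
      intro hc
      refine single_notMem_gensK33 i.succ ?_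
      suffices hTe : Pi.single i.succ 1 = T (Pi.single i.succ.succ 1) by rw [hTe]; exact hTK _ hc
      have h0 : ∀ i : Fin 8, (1 : Fin 10) ≠ i.succ.succ := by decide
      funext l
      refine Fin.cases ?_ (fun l => ?_) l
      · rw [hT0, Pi.single_eq_of_ne (Fin.succ_ne_zero _).symm, Pi.single_eq_of_ne
          (Fin.succ_ne_zero _).symm, Pi.single_eq_of_ne (h0 i), add_zero]
      · rw [hTs]
        simp [Pi.single_apply]
    · refine Fin.cases ?_ (fun i => Fin.cases ?_ (fun i => ?_) i) i
      · exact exists_ne_zero_of_not_isColoop hK hp.left_not_isColoop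
      · exact exists_ne_zero_of_not_isColoop hK hp.right_not_isColoop
      · obtain ⟨c, hc, hci⟩ := exists_mem_gensK33 i.succ
        rw [hrel] at hc
        obtain ⟨d, ⟨hd, -⟩, rfl⟩ := hc
        exact ⟨_, hd, by rw [show (d ∘ some) i.succ.succ = 1 from hci]; exact one_ne_zero⟩
  obtain ⟨n, p, hKp⟩ := hK.exists_ends hG
  rw [hKp] at hthick hrank
  -- This reads `10 + 3 ≤ 3 * dim K`, while `dim K ≤ 4`.
  have := card_add_three_le hthick
  rw [Fintype.card_fin] at this
  omega

end

/-! ### Deleting the new element -/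

theorem IsThick.map_funLeft {ι κ : Type*} [DecidableEq ι] [DecidableEq κ]
    {K : Submodule (ZMod 2) (ι → ZMod 2)} (hK : IsThick K) (τ : κ ≃ ι) :
    IsThick (K.map (LinearMap.funLeft (ZMod 2) (ZMod 2) τ)) := by
  refine ⟨fun i => ?_, fun i => ?_, fun i k hik => ?_⟩
  · rintro ⟨c, hc, hci⟩
    refine hK.single_notMem (τ i) ?_
    suffices h : Pi.single (τ i) 1 = c by rw [h]; exact hc
    funext l
    obtain ⟨l, rfl⟩ := τ.surjective l
    have := congrFun hci l
    rw [LinearMap.funLeft_apply] at this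
    simp only [this, Pi.single_apply, τ.injective.eq_iff]
  · obtain ⟨c, hc, h⟩ := hK.exists_ne_zero (τ i)
    exact ⟨_, ⟨c, hc, rfl⟩, h⟩
  · obtain ⟨c, hc, h⟩ := hK.exists_ne (τ i) (τ k) (τ.injective.ne hik)
    exact ⟨_, ⟨c, hc, rfl⟩, h⟩

theorem CycleCode.possiblyGraphic_eq_true {m : ℕ} [NeZero m] {α : Type*} {M : Matroid α}
    {e : Fin m → α} {gens : List ℕ} (h : CycleCode M e (maskCode m gens)) (hG : IsGraphic M)
    (hK : IsThick (maskCode m gens)) : possiblyGraphic m gens = true := by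
  obtain ⟨n, p, hp⟩ := h.exists_ends hG
  exact ElementSplitting.possiblyGraphic_eq_true hp hK

theorem exists_labelling_of_image_some {α : Type*} {N : Matroid (Option α)} {E : Set α}
    {g : Fin 9 → Option α} {K : Submodule (ZMod 2) (Fin 9 → ZMod 2)} (hg : CycleCode N g K)
    (hE : N.E = some '' E) :
    ∃ f : Fin 9 → α, g = some ∘ f ∧ Function.Injective f ∧ Set.range f = E := by
  obtain ⟨f, rfl⟩ := exists_eq_some_comp (g := g) fun i h => by
    have := hg.mem_ground i
    rw [h, hE] at this
    simp at this
  exact ⟨f, rfl, hg.inj.of_comp, range_eq_of_some_comp (hg.range_eq.trans hE)⟩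

section

variable {m : ℕ} {K : Submodule (ZMod 2) (Fin m → ZMod 2)} {p q : Fin m} {j : Fin 9 → Fin m}

/-- The hypotheses on the pair settle `p` and `q`. A loop elsewhere would project to a loop of
`K_{3,3}`, and a cycle of `K_{3,3}` through any other element lifts to one of `M`. -/
theorem CycleCode.isThick_of_isSplittingPair {α : Type*} {M : Matroid α} {e : Fin m → α}
    (hK : CycleCode M e K) (hs : ∀ u v : α, u ≠ v → ¬ M.IsCocircuit {u, v})
    (hp : IsSplittingPair M (e p) (e q)) (hr : ∀ i, i = p ∨ i = q ∨ i ∈ Set.range j)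
    (hj : Function.Injective j)
    (hrel : maskCode 9 gensK33 = (pairCode K p q).map (LinearMap.funLeft (ZMod 2) (ZMod 2) j)) :
    IsThick K := by
  refine hK.isThick hs (fun i => ?_) fun i => ?_
  · by_cases h1 : i = p
    · rw [h1, ← hK.isLoop_iff]; exact hp.left_not_isLoop
    by_cases h2 : i = q
    · rw [h2, ← hK.isLoop_iff]; exact hp.right_not_isLoop
    obtain ⟨l, rfl⟩ := (hr i).resolve_left h1 |>.resolve_left h2
    intro h
    refine single_notMem_gensK33 l ?_
    rw [hrel]
    refine ⟨Pi.single (j l) 1, ⟨h, ?_⟩, ?_⟩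
    · simp [Pi.single_eq_of_ne (Ne.symm h1), Pi.single_eq_of_ne (Ne.symm h2)]
    · funext k
      simp only [LinearMap.funLeft_apply, Pi.single_apply, hj.eq_iff]
  · rcases hr i with rfl | rfl | ⟨l, rfl⟩
    · exact exists_ne_zero_of_not_isColoop hK hp.left_not_isColoop
    · exact exists_ne_zero_of_not_isColoop hK hp.right_not_isColoop
    · obtain ⟨c, hc, h⟩ := exists_mem_gensK33 l
      rw [hrel] at hc
      obtain ⟨d, ⟨hd, -⟩, rfl⟩ := hc
      rw [LinearMap.funLeft_apply] at h
      exact ⟨d, hd, h ▸ one_ne_zero⟩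

theorem pairCode_map {κ : Type*} (τ : κ ≃ Fin m) (i k : κ) :
    pairCode (K.map (LinearMap.funLeft (ZMod 2) (ZMod 2) τ)) i k =
      (pairCode K (τ i) (τ k)).map (LinearMap.funLeft (ZMod 2) (ZMod 2) τ) := by
  ext c
  constructor
  · rintro ⟨⟨d, hd, rfl⟩, h⟩
    exact ⟨d, ⟨hd, h⟩, rfl⟩
  · rintro ⟨d, ⟨hd, h⟩, rfl⟩
    exact ⟨⟨d, hd, rfl⟩, h⟩

/-- Forgetting the coordinates outside the range of `j` is injective on the hyperplane and maps it
onto the cycle space of `K_{3,3}`, so lifts of the four squares generate it. -/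
theorem pairCode_eq_maskCode {G : Fin 4 → ℕ}
    (hrel : maskCode 9 gensK33 = (pairCode K p q).map (LinearMap.funLeft (ZMod 2) (ZMod 2) j))
    (hind : ∀ c ∈ pairCode K p q, c ∘ j = 0 → c = 0) (hG : ∀ l, dec m (G l) ∈ pairCode K p q)
    (hlift : ∀ l, dec m (G l) ∘ j = dec 9 (gensK33.get l)) :
    pairCode K p q = maskCode m (List.ofFn G) := by
  apply le_antisymm
  · intro c hc
    have h1 : c ∘ j ∈ maskCode 9 gensK33 := hrel ▸ ⟨c, hc, rfl⟩
    let d : Fin m → ZMod 2 := ∑ l, c (j (cotreeK33 l)) • dec m (G l)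
    have hd : d ∈ pairCode K p q := Submodule.sum_mem _ fun l _ => Submodule.smul_mem _ _ (hG l)
    have hcd : c - d = 0 := by
      refine hind _ (Submodule.sub_mem _ hc hd) ?_
      rw [Pi.sub_comp, sub_eq_zero]
      refine (eq_sum_gensK33 h1).trans ?_
      funext k
      simp only [d, Function.comp_apply, Finset.sum_apply, Pi.smul_apply, ← hlift]
    rw [sub_eq_zero.1 hcd]
    exact Submodule.sum_mem _ fun l _ => Submodule.smul_mem _ _
      (dec_mem_maskCode (List.mem_ofFn.2 ⟨l, rfl⟩))
  · refine Submodule.span_le.2 ?_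
    rintro _ ⟨g, hg, rfl⟩
    obtain ⟨l, rfl⟩ := List.mem_ofFn.1 hg
    exact hG l

end

/-- The masks with exactly one of the digits `p` and `q`, and none of the digits in `t`. -/
def candidates (m p q : ℕ) (t : List ℕ) : List ℕ :=
  (List.range (2 ^ m)).filter fun n =>
    t.all (fun i => !bit n i) && xor (bit n p) (bit n q)

theorem mem_candidates {m p q n : ℕ} {t : List ℕ} (hn : n < 2 ^ m) (ht : ∀ i ∈ t, bit n i = false)
    (hpq : bit n p ≠ bit n q) : n ∈ candidates m p q t := by
  refine List.mem_filter.2 ⟨List.mem_range.2 hn, ?_⟩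
  rw [Bool.and_eq_true, List.all_eq_true]
  exact ⟨fun i hi => by rw [ht i hi]; rfl, by simpa using hpq⟩

/-- Every code generated by a candidate and the given masks is either not the cycle space of a
graph without loops, coloops and series pairs, or equivalent to one of the target codes. -/
def checkExtensions (m : ℕ) (gens cands : List ℕ) (targets : List (List ℕ × List ℕ)) : Bool :=
  cands.all fun n => weight m n == 1 || (!possiblyGraphic m (n :: gens) ||
    targets.any fun t => isoCheck m (n :: gens) t.1 t.2)

/-- As `p` and `q` are not in series, the hyperplane is proper and one normalised mask completes its
generators. That mask is a candidate; it does not have weight one, as `M` has no loop, and it passes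
the graphicness test. -/
theorem exists_isoCheck_of_checkExtensions {m : ℕ} [NeZero m] {α : Type*} {M : Matroid α}
    {e : Fin m → α} {K : Submodule (ZMod 2) (Fin m → ZMod 2)} {p q : Fin m} {t : Fin 4 → Fin m}
    {G : Fin 4 → ℕ} {targets : List (List ℕ × List ℕ)} (h : CycleCode M e K) (hG : IsGraphic M)
    (hK : IsThick K) (hpq : p ≠ q) (hGK : pairCode K p q = maskCode m (List.ofFn G))
    (hdual : ∀ j l, dec m (G l) (t j) = if l = j then 1 else 0)
    (hcheck : checkExtensions m (List.ofFn G)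
      (candidates m p q (List.ofFn fun j => (t j).1)) targets = true) :
    ∃ gens, K = maskCode m gens ∧ ∃ s ∈ targets, isoCheck m gens s.1 s.2 = true := by
  obtain ⟨n, hn, hnt, hnpq, rfl⟩ := exists_maskCode_eq hGK hdual (hK.exists_ne p q hpq)
  refine ⟨_, rfl, ?_⟩
  have hc := List.all_eq_true.1 hcheck n (mem_candidates hn (fun i hi => by
    obtain ⟨j, rfl⟩ := List.mem_ofFn.1 hi
    exact hnt j) hnpq)
  have hw : weight m n ≠ 1 := by
    rw [weight_eq]
    intro h1
    obtain ⟨i, hi⟩ := Finset.card_eq_one.1 h1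
    refine hK.single_notMem i ?_
    suffices hni : Pi.single i 1 = dec m n by
      rw [hni]
      exact dec_mem_maskCode List.mem_cons_self
    funext l
    have hl := Finset.ext_iff.1 hi l
    simp only [Finset.mem_filter, Finset.mem_univ, true_and, Finset.mem_singleton] at hl
    by_cases hli : l = i
    · rw [hli, Pi.single_eq_same]
      rw [hli] at hl
      exact ((zmod_two_cases _).resolve_left (hl.2 rfl)).symm
    · rw [Pi.single_eq_of_ne hli]
      exact (not_not.1 fun h => hli (hl.1 h)).symm
  rw [h.possiblyGraphic_eq_true hG hK, Bool.or_eq_true, beq_iff_eq, Bool.not_true, Bool.false_or,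
    List.any_eq_true] at hc
  exact hc.resolve_left hw

/-! ### Classification of `M` when the new element is deleted -/

section

variable {α : Type*} {M : Matroid α} {x y : α} {M' : Matroid (Option α)}

theorem isIso_of_delete_contract (hG : IsGraphic M)
    (hs : ∀ u v : α, u ≠ v → ¬ M.IsCocircuit {u, v}) (hM' : IsElementSplitting M {x, y} M')
    (hp : IsSplittingPair M x y)
    (hiso : IsIso (M' ＼ {none} ／ {some x}) (cycleMatroid graphK33)) :
    IsIso M (cycleMatroid graphG6) ∨ IsIso M (cycleMatroid graphG8) := by
  have hE : (M' ＼ {none} ／ {some x}).E = some '' (M.E \ {x}) := by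
    rw [Matroid.contract_ground, Matroid.delete_ground, hM'.ground_eq]
    ext o; cases o <;> simp
  obtain ⟨g, hg, hg0⟩ := exists_cycleCode_gensK33 hiso (b := some y) (by
    rw [hE]
    exact ⟨y, ⟨hp.right_mem, hp.ne.symm⟩, rfl⟩)
  obtain ⟨f, rfl, hf, hfE⟩ := exists_labelling_of_image_some hg hE
  have hf0 : f 0 = y := Option.some_injective _ hg0
  have hxf : x ∉ Set.range f := fun h => (hfE.subset h).2 rfl
  let e : Fin 10 → α := Fin.snoc f x
  have hef : e ∘ Fin.castSucc = f := 
    funext fun i => Fin.snoc_castSucc (α := fun _ => α) x f i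
  have he9 : e 9 = x := Fin.snoc_last (α := fun _ => α) x f
  have he0 : e 0 = y := (congrFun hef 0).trans hf0
  obtain ⟨K, hK⟩ := hM'.exists_cycleCode (e := e) (Fin.snoc_injective_iff.2 ⟨hf, hxf⟩) (by
    rw [Fin.range_snoc, hfE, Set.insert_sdiff_singleton, Set.insert_eq_of_mem hp.left_mem])
  rw [← he9, ← he0] at hM' hp
  have hr : ∀ i : Fin 10, i = 9 ∨ i = 0 ∨ i ∈ Set.range Fin.castSucc := fun i =>
    Fin.lastCases (Or.inl rfl) (fun i => Or.inr (Or.inr ⟨i, rfl⟩)) i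
  have hind : ∀ c ∈ pairCode K 9 0, c ∘ Fin.castSucc = 0 → c = 0 := by
    rintro c ⟨-, h90⟩ hz
    funext i
    exact Fin.lastCases (h90.trans (congrFun hz 0)) (fun i => congrFun hz i) i
  have h1 := hM'.cycleCode_delete_contract hK (by decide) Fin.castSucc
    (Fin.castSucc_injective 9) hind (X := {some x}) (by
      have : (Set.range (Fin.castSucc : Fin 9 → Fin 10))ᶜ = {9} := by
        ext i
        rw [Set.mem_compl_iff, Set.mem_singleton_iff, Set.mem_range]
        revert i
        decide
      rw [this, Set.image_singleton, Function.comp_apply, he9])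
  rw [hef] at h1
  have hrel := hg.unique h1
  have hthick := hK.isThick_of_isSplittingPair hs hp hr (Fin.castSucc_injective 9) hrel
  -- The masks in `gensK33` with `512 = 2 ^ 9` added: `x` is digit 9 and must agree with `y`, digit
  -- 0, which lies in all four squares.
  let G : Fin 4 → ℕ := ![539, 557, 707, 837]
  have hGlift : ∀ l, dec 10 (G l) ∘ Fin.castSucc = dec 9 (gensK33.get l) := by decide
  have hGpair : ∀ l, dec 10 (G l) 9 = dec 10 (G l) 0 := by decide
  have hGK := pairCode_eq_maskCode hrel hind (G := G) (fun l => by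
    obtain ⟨c, hc, hcl⟩ := hrel ▸ dec_mem_maskCode (m := 9) (List.get_mem gensK33 l)
    suffices h : dec 10 (G l) = c by rw [h]; exact hc
    have hli : ∀ i : Fin 9, dec 10 (G l) i.castSucc = c i.castSucc := fun i =>
      (congrFun (hGlift l) i).trans (congrFun hcl i).symm
    funext i
    exact Fin.lastCases ((hGpair l).trans ((hli 0).trans hc.2.symm)) hli i) hGlift
  -- Explicit isomorphisms from the surviving candidates to `G_6` and `G_8`; entry `i` is the edge
  -- corresponding to element `i`.
  let perms6 : List (List ℕ) := [[5, 0, 6, 8, 9, 3, 4, 1, 2, 7], [5, 8, 4, 0, 9, 1, 6, 3, 2, 7],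
    [7, 5, 0, 3, 8, 1, 2, 4, 9, 6], [7, 4, 8, 0, 1, 9, 6, 2, 3, 5]]
  let perms8 : List (List ℕ) := [[8, 5, 6, 1, 4, 7, 2, 9, 0, 3], [8, 5, 6, 2, 9, 0, 1, 4, 7, 3],
    [8, 1, 2, 5, 4, 9, 6, 7, 0, 3], [8, 2, 1, 5, 9, 4, 6, 0, 7, 3], [2, 5, 6, 1, 4, 7, 3, 9, 0, 8],
    [2, 5, 6, 3, 9, 0, 1, 4, 7, 8], [2, 1, 3, 5, 4, 9, 6, 7, 0, 8], [2, 3, 1, 5, 9, 4, 6, 0, 7, 8]]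
  obtain ⟨gens, rfl, s, hs, hiso⟩ := exists_isoCheck_of_checkExtensions hK hG hthick (by decide) hGK
    (t := fun l => (cotreeK33 l).castSucc) (by decide)
    (targets := perms6.map (Prod.mk [63, 71, 140, 284, 526]) ++
      perms8.map (Prod.mk [12, 119, 135, 310, 534])) (by decide +kernel)
  rcases List.mem_append.1 hs with hs | hs <;> obtain ⟨σ, -, rfl⟩ := List.mem_map.1 hs
  · exact Or.inl (hK.isIso_of_isoCheck cycleCode_graphG6 hiso)
  · exact Or.inr (hK.isIso_of_isoCheck cycleCode_graphG8 hiso)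

theorem isIso_of_delete_contract_pair (hG : IsGraphic M)
    (hs : ∀ u v : α, u ≠ v → ¬ M.IsCocircuit {u, v}) (hM' : IsElementSplitting M {x, y} M')
    (hp : IsSplittingPair M x y)
    (hiso : IsIso (M' ＼ {none} ／ {some x, some y}) (cycleMatroid graphK33)) :
    IsIso M (cycleMatroid graphG9) := by
  have hE : (M' ＼ {none} ／ {some x, some y}).E = some '' (M.E \ {x, y}) := by
    rw [Matroid.contract_ground, Matroid.delete_ground, hM'.ground_eq]
    ext o; cases o <;> simp
  obtain ⟨g, hg⟩ := (endsCode_endsK33 ▸ cycleCode_graphK33).exists_of_isIso hiso.symm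
  obtain ⟨f, rfl, hf, hfE⟩ := exists_labelling_of_image_some hg hE
  have hxf : x ∉ Set.range f := fun h => (hfE.subset h).2 (Or.inl rfl)
  have hyf : y ∉ Set.range (Fin.snoc f x : Fin 10 → α) := by
    rw [Fin.range_snoc]
    rintro (h | h)
    · exact hp.ne h.symm
    · exact (hfE.subset h).2 (Or.inr rfl)
  let e : Fin 11 → α := Fin.snoc (Fin.snoc f x : Fin 10 → α) y
  let j : Fin 9 → Fin 11 := fun i => i.castSucc.castSucc
  have hj : Function.Injective j := (Fin.castSucc_injective 10).comp (Fin.castSucc_injective 9)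
  have hef : e ∘ j = f := funext fun i => (Fin.snoc_castSucc (α := fun _ => α) y _ _).trans
    (Fin.snoc_castSucc (α := fun _ => α) x f i)
  have he9 : e 9 = x := (Fin.snoc_castSucc (α := fun _ => α) y _ (Fin.last 9)).trans
    (Fin.snoc_last (α := fun _ => α) x f)
  have he10 : e 10 = y := Fin.snoc_last (α := fun _ => α) y _
  obtain ⟨K, hK⟩ := hM'.exists_cycleCode (e := e)
    (Fin.snoc_injective_iff.2 ⟨Fin.snoc_injective_iff.2 ⟨hf, hxf⟩, hyf⟩) (by
      rw [Fin.range_snoc, Fin.range_snoc, hfE, Set.insert_comm, hp.insert_insert_sdiff])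
  rw [← he9, ← he10] at hM' hp
  have hcases : ∀ i : Fin 11, i = 9 ∨ i = 10 ∨ i ∈ Set.range j := by
    simp only [Set.mem_range]
    decide
  have hpair : Pi.single 9 1 + Pi.single 10 1 ∉ K := by
    rw [← hK.isCircuit_pair_iff (by decide) hp.left_not_isLoop hp.right_not_isLoop]
    exact hp.not_isCircuit
  have hind : ∀ c ∈ pairCode K 9 10, c ∘ j = 0 → c = 0 := by
    rintro c ⟨hc, hpq⟩ hz
    change c 9 = c 10 at hpq
    rcases zmod_two_cases (c 9) with h | h
    · funext i
      rcases hcases i with rfl | rfl | ⟨i, rfl⟩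
      · exact h
      · exact hpq ▸ h
      · exact congrFun hz i
    · refine (hpair ?_).elim
      suffices hcd : Pi.single 9 1 + Pi.single 10 1 = c by rw [hcd]; exact hc
      have hj9 : ∀ i, j i ≠ 9 := by decide
      have hj10 : ∀ i, j i ≠ 10 := by decide
      funext i
      rcases hcases i with rfl | rfl | ⟨i, rfl⟩
      · rw [h]; decide
      · rw [← hpq, h]; decide
      · rw [Pi.add_apply, Pi.single_eq_of_ne (hj9 i), Pi.single_eq_of_ne (hj10 i), add_zero]
        exact (congrFun hz i).symm
  have h1 := hM'.cycleCode_delete_contract hK (by decide) j hj hind (X := {some x, some y}) (by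
    have : (Set.range j)ᶜ = {9, 10} := by
      ext i
      rw [Set.mem_compl_iff, Set.mem_insert_iff, Set.mem_singleton_iff, Set.mem_range]
      revert i
      decide
    rw [this, Set.image_pair, Function.comp_apply, Function.comp_apply, he9, he10])
  rw [hef] at h1
  have hrel := hg.unique h1
  have hthick := hK.isThick_of_isSplittingPair hs hp hcases hj hrel
  -- `1536 = 2 ^ 9 + 2 ^ 10`: a square lifts to a cycle containing both or neither of `x` and `y`.
  have hdec : ∀ l, ∀ b : Bool, (dec 11 (gensK33.get l + bif b then 1536 else 0) ∘ j =
      dec 9 (gensK33.get l) ∧ dec 11 (gensK33.get l + bif b then 1536 else 0) 9 =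
      bif b then 1 else 0) ∧ dec 11 (gensK33.get l + bif b then 1536 else 0) 10 =
      bif b then 1 else 0 := by decide
  have hlift : ∀ l, ∃ b : Bool,
      dec 11 (gensK33.get l + bif b then 1536 else 0) ∈ pairCode K 9 10 := by
    intro l
    obtain ⟨c, hc, hcl⟩ := hrel ▸ dec_mem_maskCode (m := 9) (List.get_mem gensK33 l)
    have hb : ∃ b : Bool, (bif b then 1 else 0) = c 9 := by
      rcases zmod_two_cases (c 9) with h | h
      · exact ⟨false, h.symm⟩
      · exact ⟨true, h.symm⟩
    obtain ⟨b, hb⟩ := hb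
    obtain ⟨⟨h1, h2⟩, h3⟩ := hdec l b
    refine ⟨b, ?_⟩
    suffices h : dec 11 (gensK33.get l + bif b then 1536 else 0) = c by rw [h]; exact hc
    funext i
    rcases hcases i with rfl | rfl | ⟨i, rfl⟩
    · exact h2.trans hb
    · exact (h3.trans hb).trans hc.2
    · exact (congrFun h1 i).trans (congrFun hcl i).symm
  choose b hb using hlift
  have hGK := pairCode_eq_maskCode hrel hind hb fun l => (hdec l (b l)).1.1
  let Ts : List (Fin 4 → ℕ) :=
    [![27, 45, 195, 325], ![1563, 45, 195, 325], ![1563, 45, 195, 1861]]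
  let shifts : List (List ℕ) := [[0, 1, 2, 3, 4, 5, 6, 7, 8, 9, 10],
    [0, 2, 1, 3, 5, 4, 6, 8, 7, 9, 10], [1, 0, 2, 4, 3, 5, 7, 6, 8, 9, 10],
    [3, 0, 6, 4, 1, 7, 5, 2, 8, 9, 10], [3, 6, 0, 4, 7, 1, 5, 8, 2, 9, 10],
    [4, 3, 5, 1, 0, 2, 7, 6, 8, 9, 10], [0, 2, 1, 6, 8, 7, 3, 5, 4, 9, 10],
    [1, 0, 2, 7, 6, 8, 4, 3, 5, 9, 10], [3, 0, 6, 5, 2, 8, 4, 1, 7, 9, 10]]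
  -- Automorphisms of `K_{3,3}`, extended to fix `x` and `y`, reduce the sixteen choices of lifts to
  -- three.
  have hsym : ∀ b : Fin 4 → Bool, ∃ T ∈ Ts, ∃ σ ∈ shifts, isoCheck 11 (List.ofFn T)
      (List.ofFn fun l => gensK33.get l + bif b l then 1536 else 0) σ = true ∧
      σ[9]? = some 9 ∧ σ[10]? = some 10 := by decide +kernel
  obtain ⟨T, hT, σ, -, hσ, hσ9, hσ10⟩ := hsym b
  obtain ⟨τ, hτσ, hτ⟩ := exists_equiv_of_isoCheck hσ
  have hτ9 : τ 9 = 9 := Fin.ext (Option.some_injective _ ((hτσ 9).symm.trans hσ9))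
  have hτ10 : τ 10 = 10 := Fin.ext (Option.some_injective _ ((hτσ 10).symm.trans hσ10))
  have hKT := pairCode_map (K := K) τ 9 10
  rw [hτ9, hτ10, hGK] at hKT
  replace hKT := hKT.trans hτ.symm
  let perms : List (List ℕ) := [[8, 4, 1, 2, 5, 7, 3, 9, 0, 10, 6],
    [8, 3, 2, 1, 0, 7, 4, 9, 5, 10, 6], [9, 0, 3, 4, 1, 8, 5, 7, 2, 6, 10],
    [9, 3, 0, 5, 2, 7, 4, 8, 1, 6, 10], [9, 4, 5, 0, 1, 7, 3, 8, 2, 6, 10],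
    [9, 5, 4, 3, 2, 8, 0, 7, 1, 6, 10], [8, 4, 1, 2, 5, 7, 3, 9, 0, 6, 10],
    [8, 3, 2, 1, 0, 7, 4, 9, 5, 6, 10], [9, 0, 3, 4, 1, 8, 5, 7, 2, 10, 6],
    [9, 3, 0, 5, 2, 7, 4, 8, 1, 10, 6], [9, 4, 5, 0, 1, 7, 3, 8, 2, 10, 6],
    [9, 5, 4, 3, 2, 8, 0, 7, 1, 10, 6]]
  have hdual : ∀ T ∈ Ts, ∀ i l, dec 11 (T l) (j (cotreeK33 i)) = if l = i then 1 else 0 := by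
    decide +kernel
  have hcheck : ∀ T ∈ Ts, checkExtensions 11 (List.ofFn T)
      (candidates 11 9 10 (List.ofFn fun i => (j (cotreeK33 i)).1))
      (perms.map (Prod.mk [63, 193, 327, 607, 1036])) = true := by decide +kernel
  have hK' := hK.reindex τ
  obtain ⟨gens, hgens, s, hs, hiso⟩ := exists_isoCheck_of_checkExtensions hK' hG
    (hthick.map_funLeft τ) (by decide) hKT (hdual T hT) (hcheck T hT)
  obtain ⟨σ, -, rfl⟩ := List.mem_map.1 hs
  exact (hgens ▸ hK').isIso_of_isoCheck cycleCode_graphG9 hiso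

end

/-! ### The minimal graphs -/

/-- The last two conditions fail on the whole code if they fail on generators, so generators
suffice; a loop could be any element of the span. -/
theorem isThick_maskCode {m : ℕ} {gens : List ℕ}
    (h1 : ∀ i, ∀ n ∈ spanList gens, dec m n ≠ Pi.single i 1)
    (h2 : ∀ i, ∃ g ∈ gens, dec m g i ≠ 0)
    (h3 : ∀ i k, i ≠ k → ∃ g ∈ gens, dec m g i ≠ dec m g k) : IsThick (maskCode m gens) := by
  refine ⟨fun i hi => ?_, fun i => ?_, fun i k hik => ?_⟩
  · obtain ⟨n, hn, h⟩ := mem_maskCode.1 hi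
    exact h1 i n hn h
  · obtain ⟨g, hg, h⟩ := h2 i
    exact ⟨_, dec_mem_maskCode hg, h⟩
  · obtain ⟨g, hg, h⟩ := h3 i k hik
    exact ⟨_, dec_mem_maskCode hg, h⟩

section

variable {m : ℕ} {α : Type*} {M : Matroid α} {e : Fin m → α} {p q : Fin m}

theorem CycleCode.isMinimalWrt {β : Type*} {F : Matroid β}
    {K : Submodule (ZMod 2) (Fin m → ZMod 2)} (hK : CycleCode M e K) (hG : IsGraphic M)
    (hthick : IsThick K) (hpq : p ≠ q) (hpar : Pi.single p 1 + Pi.single q 1 ∉ K)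
    (h : ∀ M', IsElementSplitting M {e p, e q} M' →
      (IsIso (M' ＼ {none} ／ {some (e p)}) F ∨
       IsIso (M' ＼ {none} ／ {some (e p), some (e q)}) F ∨
       IsIso M' F ∨
       IsIso (M' ／ {some (e p)}) F ∨
       IsIso (M' ／ {some (e p), some (e q)}) F)) : IsMinimalWrt M F := by
  have hloop : ∀ i, ¬ M.IsLoop (e i) := fun i => (hK.isLoop_iff i).not.2 (hthick.single_notMem i)
  have hcoloop : ∀ i, ¬ M.IsColoop (e i) := fun i hi => by
    obtain ⟨c, hc, h0⟩ := hthick.exists_ne_zero i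
    exact h0 ((hK.isColoop_iff i).1 hi c hc)
  refine ⟨hG, ?_, e p, hK.mem_ground p, e q, hK.mem_ground q, hK.inj.ne hpq, hloop p, hloop q,
    hcoloop p, hcoloop q, ?_, ?_⟩
  · intro u v huv hC
    obtain ⟨i, rfl⟩ := hK.range_eq.symm ▸ hC.subset_ground (Set.mem_insert u {v})
    obtain ⟨k, rfl⟩ := hK.range_eq.symm ▸ hC.subset_ground (Set.mem_insert_of_mem _ rfl)
    have hik : i ≠ k := fun h => huv (h ▸ rfl)
    obtain ⟨c, hc, hne⟩ := hthick.exists_ne i k hik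
    exact hne (hK.eq_of_isCocircuit_pair hik hC c hc)
  · rwa [hK.isCircuit_pair_iff hpq (hloop p) (hloop q)]
  · obtain ⟨n, d, rfl⟩ := hK.exists_ends hG
    obtain ⟨M', hM'⟩ := hK.exists_isElementSplitting {e p, e q}
    exact ⟨M', hM', h M' hM'⟩

theorem IsElementSplitting.isIso_delete_contract {M' : Matroid (Option α)} {gens : List ℕ}
    (hM' : IsElementSplitting M {e p, e q} M') (hK : CycleCode M e (maskCode m gens)) (hpq : p ≠ q)
    (j : Fin 9 → Fin m) (hj : Function.Injective j) {Y : Set (Fin m)} (hY : (Set.range j)ᶜ = Y)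
    (h1 : ∀ n ∈ spanList gens, dec m n p = dec m n q → (dec m n ∘ j = 0 → dec m n = 0) ∧
      ∃ k ∈ spanList gensK33, dec 9 k = dec m n ∘ j)
    (h2 : ∀ k ∈ gensK33, ∃ n ∈ spanList gens, dec m n p = dec m n q ∧ dec m n ∘ j = dec 9 k) :
    IsIso (M' ＼ {none} ／ (some ∘ e) '' Y) (cycleMatroid graphK33) := by
  have h := hM'.cycleCode_delete_contract hK hpq j hj (X := (some ∘ e) '' Y) (by
    rintro c ⟨hc, hcpq⟩
    obtain ⟨n, hn, rfl⟩ := mem_maskCode.1 hc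
    exact (h1 n hn hcpq).1) (by rw [hY])
  have hcode : (pairCode (maskCode m gens) p q).map (LinearMap.funLeft (ZMod 2) (ZMod 2) j) =
      maskCode 9 gensK33 := by
    apply le_antisymm
    · rintro _ ⟨c, ⟨hc, hcpq⟩, rfl⟩
      obtain ⟨n, hn, rfl⟩ := mem_maskCode.1 hc
      exact mem_maskCode.2 (h1 n hn hcpq).2
    · refine Submodule.span_le.2 ?_
      rintro _ ⟨g, hg, rfl⟩
      obtain ⟨n, hn, hnpq, hng⟩ := h2 g hg
      exact ⟨dec m n, ⟨mem_maskCode.2 ⟨n, hn, rfl⟩, hnpq⟩, hng⟩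
  exact h.isIso (hcode.trans endsCode_endsK33.symm ▸ cycleCode_graphK33)

end

/-- Here `x` is element 9 and `y` is element 0. The extra generator `584 = 2 ^ 9 + 2 ^ 6 + 2 ^ 3`
puts `x` in a triangle and gives `G_6`; `576 = 2 ^ 9 + 2 ^ 6` makes `x` parallel to element 6 and
gives `G_7` and `G_8`. -/
theorem isMinimalWrt_of_cycleCode_ten {α : Type*} {M : Matroid α} (hG : IsGraphic M) {n : ℕ}
    (hn : n = 584 ∨ n = 576) {e : Fin 10 → α}
    (hK : CycleCode M e (maskCode 10 [n, 539, 557, 707, 837])) :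
    IsMinimalWrt M (cycleMatroid graphK33) := by
  refine hK.isMinimalWrt hG (p := 9) (q := 0)
    (isThick_maskCode ?_ ?_ ?_) (by decide) ?_ fun M' hM' => Or.inl ?_
  · rcases hn with rfl | rfl <;> decide +kernel
  · rcases hn with rfl | rfl <;> decide +kernel
  · rcases hn with rfl | rfl <;> decide +kernel
  · rw [mem_maskCode]
    rcases hn with rfl | rfl <;> decide +kernel
  · have hr : (Set.range (Fin.castSucc : Fin 9 → Fin 10))ᶜ = {9} := by
      ext i
      rw [Set.mem_compl_iff, Set.mem_singleton_iff, Set.mem_range]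
      revert i
      decide
    have := hM'.isIso_delete_contract hK (by decide) Fin.castSucc (Fin.castSucc_injective 9) hr
      (by rcases hn with rfl | rfl <;> decide +kernel)
      (by rcases hn with rfl | rfl <;> decide +kernel)
    rwa [Set.image_singleton] at this

/-- Elements 9 and 10 are `x` and `y`; they both lie in the lifts of the first and the last square
and in neither of the other two. -/
theorem isMinimalWrt_of_cycleCode_eleven {α : Type*} {M : Matroid α} (hG : IsGraphic M)
    {e : Fin 11 → α} (hK : CycleCode M e (maskCode 11 [584, 1563, 45, 195, 1861])) :
    IsMinimalWrt M (cycleMatroid graphK33) := by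
  refine hK.isMinimalWrt hG (p := 9) (q := 10)
    (isThick_maskCode (by decide +kernel) (by decide +kernel) (by decide +kernel)) (by decide)
    (by rw [mem_maskCode]; decide +kernel) fun M' hM' => Or.inr (Or.inl ?_)
  have hr : (Set.range fun i : Fin 9 => i.castSucc.castSucc)ᶜ = {9, 10} := by
    ext i
    rw [Set.mem_compl_iff, Set.mem_insert_iff, Set.mem_singleton_iff, Set.mem_range]
    revert i
    decide
  have := hM'.isIso_delete_contract hK (by decide) _
    ((Fin.castSucc_injective 10).comp (Fin.castSucc_injective 9)) hr
    (by decide +kernel) (by decide +kernel)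
  rwa [Set.image_pair] at this

theorem isMinimalWrt_of_cycleCode_eight {α : Type*} {M : Matroid α} (hG : IsGraphic M)
    {e : Fin 8 → α} (hK : CycleCode M e (maskCode 8 [13, 22, 97, 162])) :
    IsMinimalWrt M (cycleMatroid graphK33) := by
  -- With `a` placed at edge 0 of `K_{3,3}`, elements 0 and 1 become edges 1 and 2, the other two
  -- edges at the vertex `Sum.inl 0`. The equation of that vertex is the one added by the splitting.
  refine hK.isMinimalWrt hG (p := 0) (q := 1)
    (isThick_maskCode (by decide +kernel) (by decide +kernel) (by decide +kernel)) (by decide)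
    (by rw [mem_maskCode]; decide +kernel) fun M' hM' => Or.inr (Or.inr (Or.inl ?_))
  have h := (hM'.cycleCode hK (by decide)).reindex (finSuccEquiv 8)
  have hcode : (splitCode (maskCode 8 [13, 22, 97, 162]) 0 1).map
      (LinearMap.funLeft (ZMod 2) (ZMod 2) (finSuccEquiv 8)) = maskCode 9 gensK33 := by
    apply le_antisymm
    · rintro _ ⟨c, ⟨hc, hcn⟩, rfl⟩
      obtain ⟨n, hn, hnc⟩ := mem_maskCode.1 hc
      have key : ∀ n ∈ spanList [13, 22, 97, 162], ∃ k ∈ spanList gensK33,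
          dec 9 k = Fin.cons (dec 8 n 0 + dec 8 n 1) (dec 8 n) := by decide +kernel
      obtain ⟨k, hk, hkn⟩ := key n hn
      refine mem_maskCode.2 ⟨k, hk, hkn.trans ?_⟩
      rw [hnc]
      funext l
      exact Fin.cases hcn.symm (fun _ => rfl) l
    · refine Submodule.span_le.2 ?_
      rintro _ ⟨g, hg, rfl⟩
      have key : ∀ g ∈ gensK33, ∃ n ∈ spanList [13, 22, 97, 162],
          Fin.cons (dec 8 n 0 + dec 8 n 1) (dec 8 n) = dec 9 g := by decide +kernel
      obtain ⟨n, hn, hng⟩ := key g hg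
      refine ⟨fun o => o.elim (dec 8 n 0 + dec 8 n 1) (dec 8 n),
        ⟨mem_maskCode.2 ⟨n, hn, rfl⟩, rfl⟩, ?_⟩
      rw [← hng]
      funext l
      exact Fin.cases rfl (fun _ => rfl) l
  exact h.isIso (hcode.trans endsCode_endsK33.symm ▸ cycleCode_graphK33)

/-- The forward direction never produces `G_7`, because `M(G_7)` and `M(G_8)` are isomorphic. Apart
from parallel edges the vertex 2 has only the neighbours 1 and 4, and doubling either edge of the
path through it gives the same cycle matroid. In the converse both graphs are therefore labelled by
the same code. -/
theorem isMinimalWrt_graphK33_iff {α : Type*} (M : Matroid α) (hM : IsGraphic M) :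
    IsMinimalWrt M (cycleMatroid graphK33) ↔
      (IsIso M (cycleMatroid graphG6) ∨ IsIso M (cycleMatroid graphG7) ∨
       IsIso M (cycleMatroid graphG8) ∨ IsIso M (cycleMatroid graphG9) ∨
       IsIso M (cycleMatroid graphG10)) := by
  constructor
  · rintro ⟨-, hs, x, hx, y, hy, hxy, h1, h2, h3, h4, h5, M', hM', h⟩
    have hp : IsSplittingPair M x y := ⟨hx, hy, hxy, h1, h2, h3, h4, h5⟩
    rcases h with h | h | h | h | h
    · rcases isIso_of_delete_contract hM hs hM' hp h with h | h
      · exact Or.inl h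
      · exact Or.inr (Or.inr (Or.inl h))
    · exact Or.inr (Or.inr (Or.inr (Or.inl (isIso_of_delete_contract_pair hM hs hM' hp h))))
    · exact Or.inr (Or.inr (Or.inr (Or.inr (isIso_graphG10_of_splitting hM' hp h))))
    · exact (not_isIso_contract_of_splitting hM hs hM' hp h).elim
    · exact (not_isIso_contract_pair_of_splitting hM hs hM' hp h).elim
  · rintro (h | h | h | h | h)
    · obtain ⟨e, he⟩ := CycleCode.exists_of_isoCheck h cycleCode_graphG6
        (gens := [584, 539, 557, 707, 837]) (σ := [5, 0, 6, 8, 9, 3, 4, 1, 2, 7])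
        (by decide +kernel)
      exact isMinimalWrt_of_cycleCode_ten hM (Or.inl rfl) he
    · obtain ⟨e, he⟩ := CycleCode.exists_of_isoCheck h cycleCode_graphG7
        (gens := [576, 539, 557, 707, 837]) (σ := [8, 5, 6, 3, 4, 7, 1, 9, 0, 2])
        (by decide +kernel)
      exact isMinimalWrt_of_cycleCode_ten hM (Or.inr rfl) he
    · obtain ⟨e, he⟩ := CycleCode.exists_of_isoCheck h cycleCode_graphG8
        (gens := [576, 539, 557, 707, 837]) (σ := [8, 5, 6, 1, 4, 7, 2, 9, 0, 3])
        (by decide +kernel)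
      exact isMinimalWrt_of_cycleCode_ten hM (Or.inr rfl) he
    · obtain ⟨e, he⟩ := CycleCode.exists_of_isoCheck h cycleCode_graphG9
        (gens := [584, 1563, 45, 195, 1861]) (σ := [8, 4, 1, 2, 5, 7, 3, 9, 0, 10, 6])
        (by decide +kernel)
      exact isMinimalWrt_of_cycleCode_eleven hM he
    · obtain ⟨e, he⟩ := CycleCode.exists_of_isoCheck h cycleCode_graphG10
        (gens := [13, 22, 97, 162]) (σ := [4, 6, 5, 0, 1, 7, 3, 2]) (by decide +kernel)
      exact isMinimalWrt_of_cycleCode_eight hM he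

end ElementSplitting

theorem mainTheorem4 {α : Type*} (M : Matroid α) (hM : ElementSplitting.IsGraphic M) :
    ElementSplitting.IsMinimalWrt M (ElementSplitting.cycleMatroid ElementSplitting.graphK33) ↔
      (ElementSplitting.IsIso M (ElementSplitting.cycleMatroid ElementSplitting.graphG6) ∨
       ElementSplitting.IsIso M (ElementSplitting.cycleMatroid ElementSplitting.graphG7) ∨
       ElementSplitting.IsIso M (ElementSplitting.cycleMatroid ElementSplitting.graphG8) ∨
       ElementSplitting.IsIso M (ElementSplitting.cycleMatroid ElementSplitting.graphG9) ∨
       ElementSplitting.IsIso M (ElementSplitting.cycleMatroid ElementSplitting.graphG10)) :=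
  ElementSplitting.isMinimalWrt_graphK33_iff M hM
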